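/- Let $\widehat{\mathbb C}=\mathbb C\cup\{\infty\}$ be the Riemann sphere. A meromorphic function $f$ on $\mathbb C$ is regarded as a map $\mathbb C\to\widehat{\mathbb C}$ (with value $\infty$ at its poles); if $f$ is nonconstant and $a\in\widehat{\mathbb C}$, let $f^*(a)$ denote the pullback divisor of $a$ on $\mathbb C$, that is, the divisor of zeros of $f-a$ counted with multiplicity if $a\in\mathbb C$, and the divisor of poles of $f$ counted with multiplicity if $a=\infty$. Let $a_1,a_2,a_3,a_4$ be four distinct points of $\widehat{\mathbb C}$ and let $b_1,b_2,b_3,b_4$ be four distinct points of $\widehat{\mathbb C}$. Let $f$ and $g$ be nonconstant meromorphic functions on $\mathbb C$ such that $f^*(a_j)=g^*(b_j)$ for $1\le j\le 4$. Then there is a Möbius transformation $L$ of $\widehat{\mathbb C}$ such that $f=L(g)$ and such that at least one of the following holds: (i) there are distinct indices $k_1,k_2,k_3\in\{1,2,3,4\}$ with $$L(b_{k_1})=a_{k_1},\quad L(b_{k_2})=a_{k_2},\quad L(b_{k_3})=a_{k_3};$$ (ii) there is a permutation $(k_1,k_2,k_3,k_4)$ of $\{1,2,3,4\}$ with $$L(b_{k_1})=a_{k_1},\quad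 L(b_{k_2})=a_{k_2},\quad L(b_{k_3})=a_{k_4},\quad L(b_{k_4})=a_{k_3}.$$ -/

import Mathlib

open Filter Topology

/-- The value at `z`, in the Riemann sphere `OnePoint ℂ`, of a meromorphic function `f`: the limit
of `f w` as `w → z`, `w ≠ z`. This does not depend on how `f : ℂ → ℂ` happens to be defined on a
discrete set (at the poles, in particular). The two lemmas below show that the limit always exists
when `f` is meromorphic at `z`, and that it is `∞` precisely at the poles. -/
noncomputable def sphereValue (f : ℂ → ℂ) (z : ℂ) : OnePoint ℂ :=
  limUnder (𝓝[≠] z) (fun w => (f w : OnePoint ℂ))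

theorem sphereValue_of_neg {f : ℂ → ℂ} {z : ℂ} (h : meromorphicOrderAt f z < 0) :
    Tendsto (fun w => (f w : OnePoint ℂ)) (𝓝[≠] z) (𝓝 (OnePoint.infty : OnePoint ℂ)) ∧
      sphereValue f z = OnePoint.infty := by
  have h1 := tendsto_cobounded_of_meromorphicOrderAt_neg h
  rw [Metric.cobounded_eq_cocompact, ← coclosedCompact_eq_cocompact] at h1
  have h2 := OnePoint.tendsto_coe_infty.comp h1
  exact ⟨h2, h2.limUnder_eq⟩

theorem sphereValue_of_nonneg {f : ℂ → ℂ} {z : ℂ} (hf : MeromorphicAt f z)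
    (h : 0 ≤ meromorphicOrderAt f z) :
    ∃ c : ℂ, Tendsto f (𝓝[≠] z) (𝓝 c) ∧ sphereValue f z = (c : OnePoint ℂ) := by
  obtain ⟨c, hc⟩ := tendsto_nhds_of_meromorphicOrderAt_nonneg hf h
  have h2 := (OnePoint.continuous_coe.tendsto c).comp hc
  exact ⟨c, hc, h2.limUnder_eq⟩

/-- The pullback divisor `f^*(a)` of a point `a` of the Riemann sphere under a meromorphic function
`f` on `ℂ`: the divisor of the poles of `f`, with multiplicities, if `a = ∞`, and the divisor of
the zeros of `f - a`, with multiplicities, if `a` is a complex number. -/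
noncomputable def pullbackDivisor (f : ℂ → ℂ) :
    OnePoint ℂ → Function.locallyFinsuppWithin (Set.univ : Set ℂ) ℤ
  | OnePoint.infty => (MeromorphicOn.divisor f Set.univ)⁻
  | OnePoint.some a => (MeromorphicOn.divisor (fun z => f z - a) Set.univ)⁺

@[simp] theorem pullbackDivisor_infty (f : ℂ → ℂ) :
    pullbackDivisor f OnePoint.infty = (MeromorphicOn.divisor f Set.univ)⁻ := rfl

@[simp] theorem pullbackDivisor_coe (f : ℂ → ℂ) (a : ℂ) :
    pullbackDivisor f (a : OnePoint ℂ) =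
      (MeromorphicOn.divisor (fun z => f z - a) Set.univ)⁺ := rfl

/-- A meromorphic function is nonconstant if the map it defines into the Riemann sphere is. -/
def IsNonconstant (f : ℂ → ℂ) : Prop :=
  ¬ ∃ c : OnePoint ℂ, ∀ z : ℂ, sphereValue f z = c

/-! In homogeneous coordinates a = (X : Y), let ℓ_a(f) = fY - X. Equality of the divisors gives
ℓ_{a_i}(f) = t u_i ℓ_{b_i}(g), with u_i entire and zero-free and t meromorphic, independent of i
(`exists_units_of_pullbackDivisor_eq`). Eliminating f and g from the four equations leaves a 4×4
determinant, that is, a linear relation among the six products u_i u_j whose coefficients are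
products of 2×2 determinants, nonzero because the points are distinct. Borel's theorem
(`exists_ne_eq_const_mul_of_sum_eq_zero`) then makes two of the u_i proportional, so
ℓ_{a_i}(f)/ℓ_{a_k}(f) is a constant multiple of ℓ_{b_i}(g)/ℓ_{b_k}(g). Hence f = L(g), with L taking
b_i to a_i and b_k to a_k.

For a remaining index j with L(b_j) ≠ a_j, f omits both a_j and L(b_j). By Picard's theorem f omits
at most two values, so if both remaining indices fail, L must interchange the two pairs.

Borel's theorem is proved by Nevanlinna's method: zero-free, linearly independent u_j with sum 1 are
quotients of minors of the matrix (u_j^(k)/u_j), whose entries are controlled by the growth of the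
u_j themselves. This forces logarithmic growth along a sequence of radii, hence constancy. -/

/-! ### Growth estimates for zero-free entire functions -/

/-- Poisson's formula, with the positive kernel bounded by its maximum on the circle. -/
theorem abs_le_of_harmonicOnNhd {h : ℂ → ℝ} {R : ℝ} {w : ℂ}
    (hh : InnerProductSpace.HarmonicOnNhd h (Metric.closedBall 0 R)) (hw : ‖w‖ < R) :
    |h w| ≤ (R + ‖w‖) / (R - ‖w‖) * Real.circleAverage (fun z ↦ |h z|) 0 R := by
  have hR : 0 < R := (norm_nonneg w).trans_lt hw
  have hwb : w ∈ Metric.ball (0 : ℂ) R := by simpa using hw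
  have hcont : ContinuousOn h (Metric.sphere 0 R) := fun z hz ↦
    (hh z (Metric.sphere_subset_closedBall hz)).1.continuousAt.continuousWithinAt
  have hk : ContinuousOn (Complex.re ∘ herglotzRieszKernel 0 w) (Metric.sphere 0 R) :=
    Complex.continuous_re.comp_continuousOn (by
      simpa [abs_of_pos hR] using continuousOn_herglotzRieszKernel_sphere hwb)
  have hint : CircleIntegrable ((Complex.re ∘ herglotzRieszKernel 0 w) • h) 0 R :=
    (hk.smul hcont).circleIntegrable hR.le
  have hint2 : CircleIntegrable (fun z ↦ ((R + ‖w‖) / (R - ‖w‖)) • |h z|) 0 R :=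
    (continuousOn_const.mul hcont.abs).circleIntegrable hR.le
  rw [← hh.circleAverage_re_herglotzRieszKernel_smul hwb]
  refine Real.abs_circleAverage_le_circleAverage_abs.trans ?_
  rw [← smul_eq_mul, ← Real.circleAverage_fun_smul]
  refine Real.circleAverage_mono hint.abs hint2 fun z hz ↦ ?_
  rw [abs_of_pos hR] at hz
  have h1 := re_herglotzRieszKernel_le hz hwb
  have h2 := le_re_herglotzRieszKernel hz hwb
  have h3 : 0 ≤ (R - ‖w - 0‖) / (R + ‖w - 0‖) := by
    have := norm_nonneg w
    simp only [sub_zero]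
    exact div_nonneg (by linarith) (by linarith)
  simp only [Pi.abs_apply, smul_eq_mul, Pi.mul_apply, Function.comp_apply, abs_mul]
  rw [herglotzRieszKernel_def, abs_of_nonneg (h3.trans h2)]
  refine mul_le_mul_of_nonneg_right (by simpa using h1) (abs_nonneg _)

/-- The disc of radius d about z stays at distance d from the circle of radius R, so the Poisson
bound controls Re α there by 2R/d times the average; Borel–Carathéodory then controls α itself.
Using 1 + average keeps the bound strictly positive. -/
theorem norm_sub_le_of_circleAverage_abs_re {α : ℂ → ℂ} (hα : Differentiable ℂ α) {R d : ℝ}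
    {z w : ℂ} (hd : 0 < d) (hz : ‖z‖ + 2 * d ≤ R) (hw : ‖w - z‖ < d) :
    ‖α w - α z‖ ≤ 2 * (4 * R * (1 + Real.circleAverage (fun z ↦ |(α z).re|) 0 R) / d)
      * ‖w - z‖ / (d - ‖w - z‖) := by
  set A := Real.circleAverage (fun z ↦ |(α z).re|) 0 R with hA
  have hA0 : 0 ≤ A := Real.circleAverage_nonneg_of_nonneg fun _ _ ↦ abs_nonneg _
  have hR : 0 < R := by have := norm_nonneg z; linarith
  have hharm : InnerProductSpace.HarmonicOnNhd (fun z ↦ (α z).re) (Metric.closedBall 0 R) :=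
    fun x _ ↦ (hα.analyticAt x).harmonicAt_re
  have key : ∀ y : ℂ, ‖y‖ ≤ ‖z‖ + d → |(α y).re| ≤ 2 * R / d * (1 + A) := by
    intro y hy
    have h1 := abs_le_of_harmonicOnNhd hharm (w := y) (by linarith)
    refine h1.trans ?_
    have h2 : (R + ‖y‖) / (R - ‖y‖) ≤ 2 * R / d :=
      div_le_div₀ (by linarith) (by linarith) hd (by linarith)
    exact mul_le_mul h2 (by linarith) hA0 (by positivity)
  set M := 4 * R * (1 + A) / d with hM
  have hMpos : 0 < M := by positivity
  set g : ℂ → ℂ := fun x ↦ α (x + z) - α z with hg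
  have := Complex.borelCaratheodory_zero (f := g) (M := M) (R := d) (z := w - z) hMpos
    (by fun_prop) (fun x hx ↦ ?_) hd (by simpa using hw) (by simp [hg])
  · simpa [hg] using this
  · have hx' : ‖x‖ < d := by simpa using hx
    have h1 := key (x + z) (by have := norm_add_le x z; linarith)
    have h2 := key z (by linarith)
    have h3 : M = 2 * R / d * (1 + A) + 2 * R / d * (1 + A) := by rw [hM]; ring
    simp only [hg, Set.mem_ofPred_eq, Complex.sub_re]
    rw [abs_le] at h1 h2
    linarith

theorem exists_exp_eq_of_ne_zero {u : ℂ → ℂ} (hu : Differentiable ℂ u) (h0 : ∀ z, u z ≠ 0) :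
    ∃ α : ℂ → ℂ, Differentiable ℂ α ∧ ∀ z, u z = Complex.exp (α z) := by
  have hd : Differentiable ℂ (fun z ↦ deriv u z / u z) :=
    (hu.contDiff (n := 2)).differentiable_deriv_two.div hu h0
  obtain ⟨α, hα0, hα⟩ := hd.isExactOn_univ.with_val_at 0 (Complex.log (u 0))
  have hα' : ∀ z, HasDerivAt α (deriv u z / u z) z := fun z ↦ hα z trivial
  refine ⟨α, fun z ↦ (hα' z).differentiableAt, fun z ↦ ?_⟩
  have hder : ∀ z, HasDerivAt (fun z ↦ u z * Complex.exp (-α z)) 0 z := by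
    intro z
    have h1 := (hu z).hasDerivAt.mul ((hα' z).neg.cexp)
    refine h1.congr_deriv ?_
    have := h0 z
    field_simp
    ring
  have h2 : ∀ z, u z * Complex.exp (-α z) = 1 := by
    intro z
    rw [is_const_of_deriv_eq_zero (fun z ↦ (hder z).differentiableAt)
      (fun z ↦ (hder z).deriv) z 0, hα0, Complex.exp_neg, Complex.exp_log (h0 0)]
    exact mul_inv_cancel₀ (h0 0)
  have h3 := h2 z
  rw [Complex.exp_neg] at h3
  field_simp [Complex.exp_ne_zero] at h3
  exact h3

/-- Borel's growth lemma. -/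
theorem exists_lt_two_mul_of_monotoneOn {T : ℝ → ℝ} (hT : MonotoneOn T (Set.Ici 1))
    (h1 : ∀ r, 1 ≤ r → 1 ≤ T r) (N : ℝ) : ∃ r, N ≤ r ∧ 1 ≤ r ∧ T (r + 1 / T r) < 2 * T r := by
  by_contra! hcon
  set r₀ := max N 1
  -- If the claim fails, T doubles at each iterate, so the increments are at most 2^(-n) and the
  -- sequence stays below r₀ + 2, where T is bounded: a contradiction.
  set x : ℕ → ℝ := fun n ↦ Nat.rec r₀ (fun _ r ↦ r + 1 / T r) n with hx
  have hxs : ∀ n, x (n + 1) = x n + 1 / T (x n) := fun n ↦ rfl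
  have hge : ∀ n, N ≤ x n ∧ 1 ≤ x n := by
    intro n
    induction n with
    | zero => exact ⟨le_max_left _ _, le_max_right _ _⟩
    | succ n ih =>
      have : 0 < 1 / T (x n) := by have := h1 _ ih.2; positivity
      rw [hxs]; constructor <;> linarith [ih.1, ih.2]
  have hgrow : ∀ n, (2 : ℝ) ^ n ≤ T (x n) := by
    intro n
    induction n with
    | zero => simpa using h1 _ (hge 0).2
    | succ n ih => rw [hxs, pow_succ]; linarith [hcon _ (hge n).1 (hge n).2]
  have hbd : ∀ n, x n ≤ r₀ + 2 - 2 * (1 / 2) ^ n := by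
    intro n
    induction n with
    | zero => simp [hx]
    | succ n ih =>
      have h2 : 1 / T (x n) ≤ (1 / 2) ^ n := by
        rw [div_pow, one_pow]
        exact one_div_le_one_div_of_le (by positivity) (hgrow n)
      rw [hxs, pow_succ]; linarith
  obtain ⟨n, hn⟩ := pow_unbounded_of_one_lt (T (r₀ + 2)) (one_lt_two (α := ℝ))
  have h3 : x n ≤ r₀ + 2 := by
    have := hbd n
    have : (0 : ℝ) ≤ 2 * (1 / 2) ^ n := by positivity
    linarith
  have h4 := hT (hge n).2 ((hge n).2.trans h3) h3
  linarith [hgrow n]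

/-- A pointwise lemma on the logarithmic derivative. Write u = exp α; on a circle of radius s about
z, α varies by at most 1, so |u| ≤ e|u(z)| there, and Cauchy's estimates apply. -/
theorem norm_iteratedDeriv_div_le {u : ℂ → ℂ} (hu : Differentiable ℂ u) (h0 : ∀ z, u z ≠ 0)
    {R d : ℝ} {z : ℂ} (hd : 0 < d) (hz : ‖z‖ + 2 * d ≤ R) (k : ℕ) :
    ‖iteratedDeriv k u z / u z‖ ≤ k.factorial * Real.exp 1 * ((1 + 2 *
      (4 * R * (1 + Real.circleAverage (fun z ↦ |Real.log ‖u z‖|) 0 R) / d)) / d) ^ k := by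
  obtain ⟨α, hα, huα⟩ := exists_exp_eq_of_ne_zero hu h0
  have hre : (fun z ↦ |Real.log ‖u z‖|) = fun z ↦ |(α z).re| := by
    ext z; rw [huα, Complex.norm_exp, Real.log_exp]
  rw [hre]
  set A := Real.circleAverage (fun z ↦ |(α z).re|) 0 R with hA
  have hA0 : 0 ≤ A := Real.circleAverage_nonneg_of_nonneg fun _ _ ↦ abs_nonneg _
  have hR : 0 < R := by have := norm_nonneg z; linarith
  set M := 4 * R * (1 + A) / d with hM
  have hMpos : 0 < M := by positivity
  -- The radius solving 2Ms/(d - s) = 1.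
  set s := d / (1 + 2 * M) with hs
  have hspos : 0 < s := by positivity
  have hsd : s < d := by rw [hs, div_lt_iff₀ (by positivity)]; nlinarith
  have hsph : ∀ w ∈ Metric.sphere z s, ‖u w‖ ≤ Real.exp 1 * ‖u z‖ := by
    intro w hw
    have hws : ‖w - z‖ = s := by simpa [dist_eq_norm] using hw
    have h1 := norm_sub_le_of_circleAverage_abs_re hα hd hz (w := w) (by rw [hws]; exact hsd)
    rw [hws, ← hA, ← hM] at h1
    have h2 : 2 * M * s / (d - s) = 1 := by
      rw [div_eq_one_iff_eq (by linarith), hs]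
      field_simp
      ring
    rw [h2] at h1
    rw [huα, huα, Complex.norm_exp, Complex.norm_exp, ← Real.exp_add, Real.exp_le_exp]
    have := (Complex.re_le_norm _).trans h1
    rw [Complex.sub_re] at this
    linarith
  have h3 := Complex.norm_iteratedDeriv_le_of_forall_mem_sphere_norm_le k hspos
    (hu.diffContOnCl (s := Metric.ball z s)) hsph
  have h4 : (1 + 2 * M) / d = s⁻¹ := by rw [hs, inv_div]
  rw [norm_div, div_le_iff₀ (norm_pos_iff.2 (h0 z)), h4, inv_pow]
  refine h3.trans (le_of_eq ?_)
  field_simp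

/-! ### Wronskians -/

/-- The Wronskian matrix of a family of functions: row `k` contains the `k`-th derivatives. -/
noncomputable def wronskianMatrix {n : ℕ} (f : Fin n → ℂ → ℂ) (z : ℂ) :
    Matrix (Fin n) (Fin n) ℂ :=
  Matrix.of fun k i ↦ iteratedDeriv k (f i) z

theorem Differentiable.iteratedDeriv_complex {f : ℂ → ℂ} (hf : Differentiable ℂ f) (k : ℕ) :
    Differentiable ℂ (iteratedDeriv k f) :=
  (hf.contDiff (n := (k + 1 : ℕ))).differentiable_iteratedDeriv k (by exact_mod_cast k.lt_succ_self)

theorem differentiable_det {n : Type*} [Fintype n] [DecidableEq n] {A : ℂ → Matrix n n ℂ}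
    (hA : ∀ i j, Differentiable ℂ fun z ↦ A z i j) : Differentiable ℂ fun z ↦ (A z).det := by
  simp only [Matrix.det_apply]
  refine Differentiable.fun_sum fun σ _ ↦ Differentiable.const_smul ?_ _
  exact Differentiable.fun_finsetProd fun i _ ↦ hA _ _

theorem differentiable_cramer {n : Type*} [Fintype n] [DecidableEq n] {A : ℂ → Matrix n n ℂ}
    {b : ℂ → n → ℂ} (hA : ∀ i j, Differentiable ℂ fun z ↦ A z i j)
    (hb : ∀ i, Differentiable ℂ fun z ↦ b z i) (j : n) :
    Differentiable ℂ fun z ↦ (A z).cramer (b z) j := by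
  simp only [Matrix.cramer_apply]
  refine differentiable_det fun i k ↦ ?_
  by_cases h : k = j
  · simpa [Matrix.updateCol_apply, h] using hb i
  · simpa [Matrix.updateCol_apply, h] using hA i k

/-- The Wronskian of linearly independent entire functions does not vanish identically. -/
theorem exists_det_wronskianMatrix_ne_zero {n : ℕ} (f : Fin n → ℂ → ℂ)
    (hf : ∀ i, Differentiable ℂ (f i)) (hli : LinearIndependent ℂ f) :
    ∃ z, (wronskianMatrix f z).det ≠ 0 := by
  induction n with
  | zero => exact ⟨0, by simp⟩
  | succ n ih =>
    by_contra! hW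
    obtain ⟨hli', hnot⟩ := linearIndependent_finSucc'.1 hli
    set g : Fin n → ℂ → ℂ := fun i ↦ f i.castSucc with hg
    set h : ℂ → ℂ := f (Fin.last n) with hh
    have hgd : ∀ i, Differentiable ℂ (g i) := fun i ↦ hf _
    obtain ⟨z₀, hz₀⟩ := ih g hgd hli'
    have hNd : ∀ k i, Differentiable ℂ fun z ↦ wronskianMatrix g z k i :=
      fun k i ↦ (hgd i).iteratedDeriv_complex k
    have hdet := differentiable_det hNd
    obtain ⟨ε, hε, hball⟩ := Metric.eventually_nhds_iff_ball.1
      (hdet.continuous.continuousAt.eventually_ne hz₀)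
    set F : ℂ → Fin n → ℂ := fun z k ↦ iteratedDeriv k h z with hF
    have hFd : ∀ k, Differentiable ℂ fun z ↦ F z k := fun k ↦ (hf _).iteratedDeriv_complex k
    -- Near z₀ the smaller Wronskian is invertible, so Cramer's rule writes the last function
    -- through the others with variable coefficients; the vanishing of the full Wronskian extends
    -- this relation to derivatives of order n.
    set c : Fin n → ℂ → ℂ :=
      fun i z ↦ (wronskianMatrix g z).cramer (F z) i / (wronskianMatrix g z).det with hc
    have hcd : ∀ i, ∀ z ∈ Metric.ball z₀ ε, DifferentiableAt ℂ (c i) z := fun i z hz ↦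
      (differentiable_cramer hNd hFd i z).div (hdet z) (hball z hz)
    have hsolve : ∀ z ∈ Metric.ball z₀ ε, ∀ v : Fin n → ℂ,
        (∀ k : Fin n, ∑ i, iteratedDeriv k (g i) z * v i = 0) → v = 0 := by
      intro z hz v hv
      refine Matrix.eq_zero_of_mulVec_eq_zero (hball z hz) ?_
      ext k
      simpa [Matrix.mulVec, dotProduct, wronskianMatrix] using hv k
    have hrel : ∀ z ∈ Metric.ball z₀ ε, ∀ k : ℕ, k ≤ n →
        iteratedDeriv k h z = ∑ i, iteratedDeriv k (g i) z * c i z := by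
      intro z hz
      have hk1 : ∀ k : Fin n, iteratedDeriv k h z = ∑ i, iteratedDeriv k (g i) z * c i z := by
        intro k
        have h1 := congrFun (Matrix.mulVec_cramer (wronskianMatrix g z) (F z)) k
        have h2 := hball z hz
        simp only [Matrix.mulVec, dotProduct, Pi.smul_apply, smul_eq_mul] at h1
        simp only [hc, ← mul_div_assoc, ← Finset.sum_div]
        rw [eq_div_iff h2, mul_comm]
        exact h1.symm
      obtain ⟨v, hv0, hv⟩ := Matrix.exists_mulVec_eq_zero_iff.2 (hW z)
      have hv' : ∀ k : ℕ, k ≤ n → ∑ i, iteratedDeriv k (g i) z * v i.castSucc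
          + iteratedDeriv k h z * v (Fin.last n) = 0 := by
        intro k hk
        have := congrFun hv ⟨k, by omega⟩
        simpa [Matrix.mulVec, dotProduct, wronskianMatrix, Fin.sum_univ_castSucc] using this
      have hvl : v (Fin.last n) ≠ 0 := by
        intro h0
        have h1 : (fun i : Fin n ↦ v i.castSucc) = 0 := hsolve z hz _ fun k ↦ by
          simpa [h0] using hv' k k.2.le
        refine hv0 (funext fun i ↦ ?_)
        refine Fin.lastCases h0 (fun i ↦ congrFun h1 i) i
      have hcv : (fun i ↦ v i.castSucc + c i z * v (Fin.last n)) = 0 := by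
        refine hsolve z hz _ fun k ↦ ?_
        have h1 := hv' k k.2.le
        rw [hk1 k] at h1
        simpa [mul_add, Finset.sum_add_distrib, Finset.sum_mul, mul_assoc] using h1
      intro k hk
      have h1 := hv' k hk
      have h2 : ∀ i, v i.castSucc = -(c i z * v (Fin.last n)) :=
        fun i ↦ eq_neg_of_add_eq_zero_left (congrFun hcv i)
      simp only [h2] at h1
      have h3 : (iteratedDeriv k h z - ∑ i, iteratedDeriv k (g i) z * c i z)
          * v (Fin.last n) = 0 := by
        rw [← h1, sub_mul, Finset.sum_mul]
        simp only [mul_neg, Finset.sum_neg_distrib, mul_assoc]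
        ring
      exact sub_eq_zero.1 ((mul_eq_zero.1 h3).resolve_right hvl)
    -- Differentiating the k-th relation and subtracting the (k+1)-st shows that the derivatives of
    -- the c_i solve the homogeneous system.
    have hc0 : ∀ i, ∀ z ∈ Metric.ball z₀ ε, deriv (c i) z = 0 := by
      intro i z hz
      refine congrFun (hsolve z hz (fun i ↦ deriv (c i) z) fun k ↦ ?_) i
      have h1 : HasDerivAt (iteratedDeriv k h) (∑ i, (deriv (iteratedDeriv k (g i)) z * c i z
          + iteratedDeriv k (g i) z * deriv (c i) z)) z := by
        refine HasDerivAt.congr_of_eventuallyEq (f := fun z ↦ ∑ i, iteratedDeriv k (g i) z * c i z)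
          (HasDerivAt.fun_sum fun i _ ↦ ?_) ?_
        · exact ((hgd i).iteratedDeriv_complex k z).hasDerivAt.mul (hcd i z hz).hasDerivAt
        · filter_upwards [Metric.isOpen_ball.mem_nhds hz] with w hw using hrel w hw k k.2.le
      have h2 := h1.deriv
      rw [← iteratedDeriv_succ, hrel z hz (k + 1) k.2, Finset.sum_add_distrib] at h2
      simp only [← iteratedDeriv_succ] at h2
      simpa using h2
    have hconst : ∀ z ∈ Metric.ball z₀ ε, ∀ i, c i z = c i z₀ := fun z hz i ↦
      Metric.isOpen_ball.is_const_of_deriv_eq_zero (convex_ball z₀ ε).isPreconnected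
        (fun w hw ↦ (hcd i w hw).differentiableWithinAt) (fun w hw ↦ hc0 i w hw) hz
        (Metric.mem_ball_self hε)
    have heq : h = fun z ↦ ∑ i, g i z * c i z₀ := by
      refine AnalyticOnNhd.eq_of_eventuallyEq (𝕜 := ℂ) (z₀ := z₀) ?_ ?_ ?_
      · exact fun z _ ↦ (hf _).analyticAt z
      · have : Differentiable ℂ fun z ↦ ∑ i, g i z * c i z₀ :=
          Differentiable.fun_sum fun i _ ↦ (hgd i).mul_const _
        exact fun z _ ↦ this.analyticAt z
      · filter_upwards [Metric.ball_mem_nhds z₀ hε] with z hz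
        have := hrel z hz 0 (Nat.zero_le _)
        simpa [hconst z hz] using this
    refine hnot ?_
    have h4 : h = ∑ i, c i z₀ • g i := by
      rw [heq]; ext z; simp [mul_comm]
    rw [h4]
    exact Submodule.sum_mem _ fun i _ ↦ Submodule.smul_mem _ _
      (Submodule.subset_span ⟨i, rfl⟩)

/-! ### Proximity functions of entire functions -/

open ValueDistribution in
theorem Differentiable.logCounting_top_eq_zero {f : ℂ → ℂ} (hf : Differentiable ℂ f) :
    logCounting f ⊤ = 0 := by
  have h1 : (0 : Function.locallyFinsuppWithin (Set.univ : Set ℂ) ℤ) ≤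
      MeromorphicOn.divisor f Set.univ :=
    MeromorphicOn.AnalyticOnNhd.divisor_nonneg fun z _ ↦ hf.analyticAt z
  rw [logCounting_top, negPart_eq_zero.2 h1, map_zero]

theorem Differentiable.meromorphic_complex {f : ℂ → ℂ} (hf : Differentiable ℂ f) :
    Meromorphic f := fun z ↦ (hf.analyticAt z).meromorphicAt

open ValueDistribution in
theorem Differentiable.characteristic_top_eq {f : ℂ → ℂ} (hf : Differentiable ℂ f) :
    characteristic f ⊤ = proximity f ⊤ := by
  rw [characteristic, hf.logCounting_top_eq_zero, add_zero]

-- First main theorem: an entire function has no poles to count, and the counting function of its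
-- inverse is nonnegative for r ≥ 1.
open ValueDistribution in
theorem Differentiable.proximity_inv_le {f : ℂ → ℂ} (hf : Differentiable ℂ f) {r : ℝ}
    (hr : 1 ≤ r) :
    proximity f⁻¹ ⊤ r ≤ proximity f ⊤ r - Real.log ‖meromorphicTrailingCoeffAt f 0‖ := by
  have h1 := characteristic_sub_characteristic_inv_of_ne_zero hf.meromorphic_complex
    (R := r) (by positivity)
  rw [hf.characteristic_top_eq] at h1
  have h2 : 0 ≤ logCounting f⁻¹ ⊤ r := logCounting_nonneg hr
  rw [characteristic, Pi.add_apply] at h1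
  linarith

open ValueDistribution in
theorem Differentiable.monotoneOn_proximity_top {f : ℂ → ℂ} (hf : Differentiable ℂ f) :
    MonotoneOn (proximity f ⊤) (Set.Ioi 0) := by
  rw [← hf.characteristic_top_eq]
  exact characteristic_monotoneOn hf.meromorphic_complex

-- |log| = 2 log⁺ - log, and log‖u‖ is harmonic, so its circle average is its value at 0.
open ValueDistribution in
theorem circleAverage_abs_log_norm_eq {u : ℂ → ℂ} (hu : Differentiable ℂ u)
    (h0 : ∀ z, u z ≠ 0) (r : ℝ) :
    Real.circleAverage (fun z ↦ |Real.log ‖u z‖|) 0 r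
      = 2 * proximity u ⊤ r - Real.log ‖u 0‖ := by
  have hmean : Real.circleAverage (fun z ↦ Real.log ‖u z‖) 0 r = Real.log ‖u 0‖ :=
    InnerProductSpace.HarmonicOnNhd.circleAverage_eq
      fun z _ ↦ (hu.analyticAt z).harmonicAt_log_norm (h0 z)
  have hi1 : CircleIntegrable (fun z ↦ Real.log ‖u z‖) 0 r :=
    hu.meromorphic_complex.meromorphicOn.circleIntegrable_log_norm
  have hprox : (fun z ↦ |Real.log ‖u z‖|) =
      fun z ↦ (2 : ℝ) • Real.posLog ‖u z‖ - Real.log ‖u z‖ := by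
    ext z
    rw [← Real.half_mul_log_add_log_abs, smul_eq_mul]
    ring
  have hi2 : CircleIntegrable (fun z ↦ (2 : ℝ) • Real.posLog ‖u z‖) 0 r :=
    (hu.meromorphic_complex.meromorphicOn.circleIntegrable_posLog_norm).const_fun_smul
  rw [hprox, Real.circleAverage_fun_sub hi2 hi1, Real.circleAverage_fun_smul, hmean,
    proximity_top, smul_eq_mul]

open ValueDistribution in
theorem proximity_le_of_norm_le {f : ℂ → ℂ} (hf : Differentiable ℂ f) {r K : ℝ} (hr : 0 ≤ r)
    (hK : 1 ≤ K) (h : ∀ z, ‖z‖ = r → ‖f z‖ ≤ K) : proximity f ⊤ r ≤ Real.log K := by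
  rw [proximity_top]
  refine Real.circleAverage_mono_on_of_le_circle
    hf.meromorphic_complex.meromorphicOn.circleIntegrable_posLog_norm fun z hz ↦ ?_
  rw [← Real.posLog_eq_log (by rwa [abs_of_nonneg (by linarith)])]
  exact Real.posLog_le_posLog (norm_nonneg _) (h z (by simpa [abs_of_nonneg hr] using hz))

/-- A Liouville argument for a logarithm α of u: with d = r/2 the estimate for α w - α 0 is O((1 +
log r)/r) along a sequence r → ∞. -/
theorem eq_const_of_circleAverage_le {u : ℂ → ℂ} (hu : Differentiable ℂ u)
    (h0 : ∀ z, u z ≠ 0) {C : ℝ} (h : ∀ N : ℝ, ∃ r, N ≤ r ∧ 1 ≤ r ∧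
      Real.circleAverage (fun z ↦ |Real.log ‖u z‖|) 0 r ≤ C * (1 + Real.log r)) (w : ℂ) :
    u w = u 0 := by
  obtain ⟨α, hα, huα⟩ := exists_exp_eq_of_ne_zero hu h0
  have hre : (fun z ↦ |Real.log ‖u z‖|) = fun z ↦ |(α z).re| := by
    ext z; rw [huα, Complex.norm_exp, Real.log_exp]
  rw [hre] at h
  have key : Tendsto (fun r : ℝ ↦ 16 * ‖w‖ * (1 + C * (1 + Real.log r)) / (r / 2 - ‖w‖))
      atTop (𝓝 0) := by
    have hl : (fun _ : ℝ ↦ (1 : ℝ)) =o[atTop] (fun r : ℝ ↦ r) :=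
      Asymptotics.isLittleO_const_id_atTop 1
    have hlog : (fun r : ℝ ↦ Real.log r) =o[atTop] (fun r : ℝ ↦ r) := Real.isLittleO_log_id_atTop
    have hnum : (fun r : ℝ ↦ 16 * ‖w‖ * (1 + C * (1 + Real.log r))) =o[atTop] (fun r : ℝ ↦ r) :=
      (hl.add ((hl.add hlog).const_mul_left C)).const_mul_left _
    have hden : (fun r : ℝ ↦ r) =O[atTop] (fun r : ℝ ↦ r / 2 - ‖w‖) := by
      refine Asymptotics.IsBigO.of_bound 4 ?_
      filter_upwards [eventually_ge_atTop (4 * ‖w‖), eventually_ge_atTop 0] with r h1 h2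
      have := norm_nonneg w
      rw [Real.norm_of_nonneg h2, Real.norm_of_nonneg (by linarith)]
      linarith
    exact (hnum.trans_isBigO hden).tendsto_div_nhds_zero
  have hzero : ‖α w - α 0‖ ≤ 0 := by
    refine le_of_forall_pos_le_add fun ε hε ↦ ?_
    obtain ⟨N, hN⟩ := eventually_atTop.1 (key.eventually (gt_mem_nhds hε))
    obtain ⟨r, hr, hr1, hA⟩ := h (max N (2 * ‖w‖ + 1))
    have hw : ‖w‖ < r / 2 := by have := (le_max_right _ _).trans hr; linarith
    have h1 := norm_sub_le_of_circleAverage_abs_re hα (R := r) (d := r / 2) (z := 0) (w := w)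
      (by positivity) (by simp; linarith) (by simpa using hw)
    have h2 := hN r ((le_max_left _ _).trans hr)
    rw [sub_zero] at h1
    refine h1.trans (le_trans ?_ (zero_add ε ▸ h2.le))
    refine div_le_div_of_nonneg_right ?_ (by linarith)
    have h3 : 2 * (4 * r * (1 + Real.circleAverage (fun z ↦ |(α z).re|) 0 r) / (r / 2)) * ‖w‖
        = 16 * ‖w‖ * (1 + Real.circleAverage (fun z ↦ |(α z).re|) 0 r) := by
      field_simp; ring
    rw [h3]
    gcongr
  rw [huα, huα, sub_eq_zero.1 (norm_le_zero_iff.1 hzero)]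

/-- If `T ≤ a + b log r + c log T`, then `T` grows at most logarithmically. -/
theorem le_mul_one_add_log {a b c T r : ℝ} (ha : 0 ≤ a) (hb : 0 ≤ b) (hc : 0 ≤ c) (hT : 1 ≤ T)
    (hr : 1 ≤ r) (h : T ≤ a + b * Real.log r + c * Real.log T) :
    T ≤ 2 * (a + b + c * Real.log (2 * c + 1)) * (1 + Real.log r) := by
  -- The scale 2c + 1 lets c log T be absorbed into T/2 plus a constant.
  have h1 : Real.log T ≤ T / (2 * c + 1) + Real.log (2 * c + 1) := by
    have h2 := Real.log_le_sub_one_of_pos (x := T / (2 * c + 1)) (by positivity)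
    rw [Real.log_div (by positivity) (by positivity)] at h2
    linarith
  have h3 : c * (T / (2 * c + 1)) ≤ T / 2 := by
    rw [← mul_div_assoc, div_le_div_iff₀ (by positivity) two_pos]
    nlinarith
  have h4 : c * Real.log T ≤ T / 2 + c * Real.log (2 * c + 1) := by
    have := mul_le_mul_of_nonneg_left h1 hc
    rw [mul_add] at this
    linarith
  have h5 : 0 ≤ Real.log r := Real.log_nonneg hr
  have h6 : 0 ≤ c * Real.log (2 * c + 1) := mul_nonneg hc (Real.log_nonneg (by linarith))
  nlinarith [mul_nonneg ha h5, mul_nonneg h6 h5]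

theorem norm_det_le {n : ℕ} {A : Matrix (Fin n) (Fin n) ℂ} {B : ℝ} (h : ∀ i j, ‖A i j‖ ≤ B) :
    ‖A.det‖ ≤ n.factorial * B ^ n := by
  have := Matrix.det_le (A := A) (abv := NormedField.toAbsoluteValue ℂ) (x := B) h
  rwa [Fintype.card_fin, nsmul_eq_mul] at this

/-! ### Borel's theorem on sums of zero-free entire functions -/

/-- The matrix of quotients `u_j^(k) / u_j` of a family of functions without zeros. -/
noncomputable def logWronskianMatrix {n : ℕ} (u : Fin n → ℂ → ℂ) (z : ℂ) :
    Matrix (Fin n) (Fin n) ℂ :=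
  Matrix.of fun k j ↦ iteratedDeriv k (u j) z / u j z

theorem differentiable_logWronskianMatrix {n : ℕ} {u : Fin n → ℂ → ℂ}
    (hu : ∀ j, Differentiable ℂ (u j)) (h0 : ∀ j z, u j z ≠ 0) (k j : Fin n) :
    Differentiable ℂ fun z ↦ logWronskianMatrix u z k j :=
  ((hu j).iteratedDeriv_complex k).fun_div (hu j) (h0 j)

theorem exists_det_logWronskianMatrix_ne_zero {n : ℕ} {u : Fin n → ℂ → ℂ}
    (hu : ∀ j, Differentiable ℂ (u j)) (h0 : ∀ j z, u j z ≠ 0) (hli : LinearIndependent ℂ u) :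
    ∃ z, (logWronskianMatrix u z).det ≠ 0 := by
  obtain ⟨z, hz⟩ := exists_det_wronskianMatrix_ne_zero u hu hli
  refine ⟨z, fun h ↦ hz ?_⟩
  have : wronskianMatrix u z = Matrix.of fun k j ↦ u j z * logWronskianMatrix u z k j := by
    ext k j
    simp only [wronskianMatrix, logWronskianMatrix, Matrix.of_apply]
    exact (mul_div_cancel₀ _ (h0 j z)).symm
  rw [this, Matrix.det_mul_row, h, mul_zero]

/-- The growth lemma supplies the outer radius r + 1/t; taking d = 1/(2t) makes r + 2d equal to it.
The constant is 130 = 2(1 + 64). -/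
theorem norm_logWronskianMatrix_le {n : ℕ} {u : Fin (n + 1) → ℂ → ℂ}
    (hu : ∀ j, Differentiable ℂ (u j)) (h0 : ∀ j z, u j z ≠ 0) {r t : ℝ} (hr : 1 ≤ r) (ht : 1 ≤ t)
    (hA : ∀ j, 1 + Real.circleAverage (fun z ↦ |Real.log ‖u j z‖|) 0 (r + 1 / t) ≤ 2 * t)
    {z : ℂ} (hz : ‖z‖ = r) (k j : Fin (n + 1)) :
    ‖logWronskianMatrix u z k j‖ ≤ n.factorial * Real.exp 1 * (130 * r * t ^ 3) ^ n := by
  have ht0 : 0 < t := by linarith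
  have h1 := norm_iteratedDeriv_div_le (hu j) (h0 j) (R := r + 1 / t) (d := 1 / (2 * t)) (z := z)
    (by positivity) (by rw [hz]; apply le_of_eq; field_simp) k
  set A := Real.circleAverage (fun z ↦ |Real.log ‖u j z‖|) 0 (r + 1 / t)
  have hA0 : 0 ≤ A := Real.circleAverage_nonneg_of_nonneg fun _ _ ↦ abs_nonneg _
  have ht1 : 1 / t ≤ 1 := by rw [div_le_one ht0]; exact ht
  have h2 : (1 + 2 * (4 * (r + 1 / t) * (1 + A) / (1 / (2 * t)))) / (1 / (2 * t))
      ≤ 130 * r * t ^ 3 := by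
    have h3 : (r + 1 / t) * (1 + A) ≤ (2 * r) * (2 * t) :=
      mul_le_mul (by linarith) (hA j) (by linarith) (by linarith)
    have h4 : (1 + 2 * (4 * (r + 1 / t) * (1 + A) / (1 / (2 * t)))) / (1 / (2 * t))
        = (1 + 16 * t * ((r + 1 / t) * (1 + A))) * (2 * t) := by
      field_simp; ring
    rw [h4]
    calc (1 + 16 * t * ((r + 1 / t) * (1 + A))) * (2 * t)
        ≤ (r * t ^ 2 + 16 * t * ((2 * r) * (2 * t))) * (2 * t) := by
          gcongr
          exact one_le_mul_of_one_le_of_one_le hr (one_le_pow₀ ht)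
      _ = 130 * r * t ^ 3 := by ring
  have h5 : 1 ≤ 130 * r * t ^ 3 := by
    have : 1 ≤ r * t ^ 3 := one_le_mul_of_one_le_of_one_le hr (one_le_pow₀ ht)
    linarith
  have hkn : (k : ℕ) ≤ n := Nat.lt_succ_iff.1 k.2
  refine h1.trans ?_
  gcongr
  calc _ ≤ (130 * r * t ^ 3) ^ (k : ℕ) := by
        refine pow_le_pow_left₀ ?_ h2 _
        have : 0 ≤ r + 1 / t := by positivity
        positivity
    _ ≤ _ := pow_le_pow_right₀ h5 hkn

-- Differentiating ∑ u_j = 1 shows that (u_j) solves a linear system with matrix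
-- `logWronskianMatrix` and right side (1, 0, …, 0). By Cramer's rule u_j is a quotient of two
-- determinants with entries bounded by B on the circle; the first main theorem handles the inverse
-- of the denominator.
open ValueDistribution in
theorem proximity_le_of_sum_eq_one {n : ℕ} {u : Fin (n + 1) → ℂ → ℂ}
    (hu : ∀ j, Differentiable ℂ (u j)) (h0 : ∀ j z, u j z ≠ 0)
    (hli : LinearIndependent ℂ u) (hsum : ∀ z, ∑ j, u j z = 1) {r B : ℝ} (hr : 1 ≤ r) (hB : 1 ≤ B)
    (hP : ∀ z, ‖z‖ = r → ∀ k j, ‖logWronskianMatrix u z k j‖ ≤ B) (j : Fin (n + 1)) :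
    proximity (u j) ⊤ r ≤ 2 * Real.log ((n + 1).factorial * B ^ (n + 1)) -
      Real.log ‖meromorphicTrailingCoeffAt (fun z ↦ (logWronskianMatrix u z).det) 0‖ := by
  set Δ : ℂ → ℂ := fun z ↦ (logWronskianMatrix u z).det with hΔ
  set e : Fin (n + 1) → ℂ := Pi.single 0 1 with he
  set cof : ℂ → ℂ := fun z ↦ (logWronskianMatrix u z).cramer e j with hcof
  have hPd := differentiable_logWronskianMatrix hu h0
  have hΔd : Differentiable ℂ Δ := differentiable_det hPd
  have hcofd : Differentiable ℂ cof :=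
    differentiable_cramer (b := fun _ ↦ e) hPd (fun i ↦ differentiable_const _) j
  have hK : 1 ≤ ((n + 1).factorial : ℝ) * B ^ (n + 1) :=
    one_le_mul_of_one_le_of_one_le (Nat.one_le_cast.2 (Nat.factorial_pos _)) (one_le_pow₀ hB)
  have hr0 : 0 ≤ r := by linarith
  have hsumk : ∀ (k : Fin (n + 1)) (z : ℂ), ∑ i, iteratedDeriv k (u i) z = e k := by
    intro k z
    have h1 : (fun z ↦ ∑ i, u i z) = fun _ ↦ (1 : ℂ) := funext hsum
    have h2 : iteratedDeriv k (fun z ↦ ∑ i, u i z) z = ∑ i, iteratedDeriv k (u i) z :=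
      iteratedDeriv_fun_sum fun i _ ↦ (hu i).contDiff.contDiffAt
    rw [← h2, h1, iteratedDeriv_const, he, Pi.single_apply]
    simp only [Fin.val_eq_zero_iff]
  have hcramer : ∀ z, cof z = Δ z * u j z := by
    intro z
    have h1 : (logWronskianMatrix u z).mulVec (fun i ↦ u i z) = e := by
      ext k
      rw [← hsumk k z]
      simp only [Matrix.mulVec, dotProduct, logWronskianMatrix, Matrix.of_apply]
      exact Finset.sum_congr rfl fun i _ ↦ div_mul_cancel₀ _ (h0 i z)
    rw [hcof]
    simp only
    rw [Matrix.cramer_eq_adjugate_mulVec, ← h1, Matrix.mulVec_mulVec, Matrix.adjugate_mul,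
      Matrix.smul_mulVec, Matrix.one_mulVec]
    rfl
  have hΔne : ∃ z, Δ z ≠ 0 := exists_det_logWronskianMatrix_ne_zero hu h0 hli
  have hcod : ∀ᶠ z in codiscrete ℂ, Δ z ≠ 0 := by
    obtain ⟨z, hz⟩ := hΔne
    exact AnalyticOnNhd.preimage_zero_mem_codiscrete (fun z _ ↦ hΔd.analyticAt z) hz
  have heq : u j =ᶠ[codiscrete ℂ] cof * Δ⁻¹ := by
    filter_upwards [hcod] with z hz
    simp only [Pi.mul_apply, Pi.inv_apply, hcramer]
    field_simp
  have hcofb : proximity cof ⊤ r ≤ Real.log ((n + 1).factorial * B ^ (n + 1)) := by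
    refine proximity_le_of_norm_le hcofd hr0 hK fun z hz ↦ ?_
    simp only [hcof, Matrix.cramer_apply]
    refine norm_det_le fun i k ↦ ?_
    rw [Matrix.updateCol_apply]
    split_ifs
    · rw [he, Pi.single_apply]
      split_ifs <;> simp <;> linarith
    · exact hP z hz i k
  have hΔb : proximity Δ ⊤ r ≤ Real.log ((n + 1).factorial * B ^ (n + 1)) :=
    proximity_le_of_norm_le hΔd hr0 hK fun z hz ↦ norm_det_le (hP z hz)
  have h1 := hΔd.proximity_inv_le hr
  have h2 := proximity_mul_top_le hcofd.meromorphic_complex hΔd.meromorphic_complex.inv r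
  rw [proximity_congr_codiscrete heq (by positivity)]
  rw [Pi.add_apply] at h2
  linarith

open ValueDistribution in
theorem eq_const_of_sum_eq_one {n : ℕ} {u : Fin (n + 1) → ℂ → ℂ}
    (hu : ∀ j, Differentiable ℂ (u j)) (h0 : ∀ j z, u j z ≠ 0)
    (hli : LinearIndependent ℂ u) (hsum : ∀ z, ∑ j, u j z = 1) (j : Fin (n + 1)) (w : ℂ) :
    u j w = u j 0 := by
  -- T is monotone, at least 1, and dominates 1 plus every average of |log‖u_j‖|, as the growth
  -- lemma and the matrix bound require.
  set T : ℝ → ℝ := fun r ↦ 1 + ∑ j, (|Real.log ‖u j 0‖| + 2 * proximity (u j) ⊤ r) with hT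
  have hprox0 : ∀ i r, 0 ≤ proximity (u i) ⊤ r := fun i r ↦ proximity_nonneg r
  have hT1 : ∀ r, 1 ≤ T r := by
    intro r
    have : 0 ≤ ∑ j, (|Real.log ‖u j 0‖| + 2 * proximity (u j) ⊤ r) :=
      Finset.sum_nonneg fun i _ ↦ by have := hprox0 i r; positivity
    simp only [hT]; linarith
  have hTmono : MonotoneOn T (Set.Ici 1) := by
    intro a ha b hb hab
    rw [Set.mem_Ici] at ha hb
    have : ∀ i, proximity (u i) ⊤ a ≤ proximity (u i) ⊤ b := fun i ↦
      (hu i).monotoneOn_proximity_top (by rw [Set.mem_Ioi]; linarith)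
        (by rw [Set.mem_Ioi]; linarith) hab
    simp only [hT]
    gcongr with i _
    exact this i
  have hAT : ∀ i r, 1 + Real.circleAverage (fun z ↦ |Real.log ‖u i z‖|) 0 r ≤ T r := by
    intro i r
    rw [circleAverage_abs_log_norm_eq (hu i) (h0 i)]
    have h1 := Finset.single_le_sum (f := fun j ↦ |Real.log ‖u j 0‖| + 2 * proximity (u j) ⊤ r)
      (fun i _ ↦ by have := hprox0 i r; positivity) (Finset.mem_univ i)
    have h2 := neg_abs_le (Real.log ‖u i 0‖)
    simp only [hT] at h1 ⊢
    linarith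
  set κ := |Real.log ‖meromorphicTrailingCoeffAt (fun z ↦ (logWronskianMatrix u z).det) 0‖|
  set F := Real.log ((n + 1).factorial : ℝ)
  set G := Real.log (n.factorial * Real.exp 1)
  have hF : 0 ≤ F := Real.log_nonneg (Nat.one_le_cast.2 (Nat.factorial_pos _))
  have hG1 : 1 ≤ (n.factorial : ℝ) * Real.exp 1 :=
    one_le_mul_of_one_le_of_one_le (Nat.one_le_cast.2 (Nat.factorial_pos _)) (Real.one_le_exp zero_le_one)
  have hG : 0 ≤ G := Real.log_nonneg hG1
  -- The constants a, b, c collect the terms of T(r) ≤ a + b log r + c log T(r) obtained by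
  -- expanding the logarithm of the determinant bound.
  set a : ℝ := 1 + ∑ j, |Real.log ‖u j 0‖| +
    (n + 1) * (2 * (2 * (F + (n + 1) * (G + n * Real.log 130)) + κ))
  set b : ℝ := (n + 1) * (2 * (2 * ((n + 1) * n)))
  set c : ℝ := (n + 1) * (2 * (2 * ((n + 1) * (n * 3))))
  have hl130 : 0 ≤ Real.log 130 := Real.log_nonneg (by norm_num)
  have ha : 0 ≤ a := by positivity
  have hb : 0 ≤ b := by positivity
  have hc : 0 ≤ c := by positivity
  refine eq_const_of_circleAverage_le (hu j) (h0 j)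
    (C := 2 * (a + b + c * Real.log (2 * c + 1))) (fun N ↦ ?_) w
  obtain ⟨r, hrN, hr1, hr⟩ := exists_lt_two_mul_of_monotoneOn hTmono (fun r _ ↦ hT1 r) N
  refine ⟨r, hrN, hr1, ?_⟩
  have ht := hT1 r
  refine le_trans (by linarith [hAT j r]) (le_mul_one_add_log ha hb hc ht hr1 ?_)
  set B : ℝ := n.factorial * Real.exp 1 * (130 * r * T r ^ 3) ^ n with hB
  have hB1 : 1 ≤ B := by
    have : 1 ≤ r * T r ^ 3 := one_le_mul_of_one_le_of_one_le hr1 (one_le_pow₀ ht)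
    exact one_le_mul_of_one_le_of_one_le hG1 (one_le_pow₀ (by linarith))
  have hP : ∀ z, ‖z‖ = r → ∀ k j, ‖logWronskianMatrix u z k j‖ ≤ B := fun z hz k j ↦
    norm_logWronskianMatrix_le hu h0 hr1 ht (fun i ↦ (hAT i _).trans hr.le) hz k j
  have hlogB : Real.log ((n + 1).factorial * B ^ (n + 1)) = F + (n + 1) * (G + n *
      (Real.log 130 + Real.log r + 3 * Real.log (T r))) := by
    have hrp : 0 < r := by linarith
    have htp : 0 < T r := by linarith
    have hlog1 : Real.log (130 * r * T r ^ 3) =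
        Real.log 130 + Real.log r + 3 * Real.log (T r) := by
      rw [Real.log_mul (by positivity) (by positivity), Real.log_mul (by positivity) hrp.ne',
        Real.log_pow]
      norm_num
    rw [Real.log_mul (by positivity) (by positivity), Real.log_pow, hB,
      Real.log_mul (by positivity) (by positivity), Real.log_pow, hlog1]
    push_cast
    ring
  have hpr : ∀ i, proximity (u i) ⊤ r ≤ 2 * (F + (n + 1) * (G + n *
      (Real.log 130 + Real.log r + 3 * Real.log (T r)))) + κ := by
    intro i
    have h1 := proximity_le_of_sum_eq_one hu h0 hli hsum hr1 hB1 hP i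
    rw [hlogB] at h1
    exact h1.trans (by
      linarith [neg_abs_le (Real.log ‖meromorphicTrailingCoeffAt
        (fun z ↦ (logWronskianMatrix u z).det) 0‖)])
  have hTle : T r ≤ 1 + ∑ j, |Real.log ‖u j 0‖| + ∑ _j : Fin (n + 1), 2 * (2 * (F + (n + 1) *
      (G + n * (Real.log 130 + Real.log r + 3 * Real.log (T r)))) + κ) := by
    conv_lhs => simp only [hT]
    rw [Finset.sum_add_distrib, ← add_assoc]
    gcongr with i _
    exact hpr i
  refine hTle.trans (le_of_eq ?_)
  rw [Finset.sum_const, Finset.card_univ, Fintype.card_fin, nsmul_eq_mul]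
  push_cast
  simp only [a, b, c]
  ring

/-- **Borel's theorem**: if a finite sum of entire functions without zeros vanishes, then each of
them is proportional to another one. -/
theorem exists_ne_eq_const_mul_of_sum_eq_zero {ι : Type*} [Fintype ι] [DecidableEq ι]
    {u : ι → ℂ → ℂ} (hu : ∀ i, Differentiable ℂ (u i)) (h0 : ∀ i z, u i z ≠ 0)
    (hsum : ∀ z, ∑ i, u i z = 0) (i : ι) :
    ∃ j, j ≠ i ∧ ∃ c : ℂ, ∀ z, u j z = c * u i z := by
  set v : {j // j ≠ i} → ℂ → ℂ := fun j z ↦ u j z / u i z with hv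
  have hvd : ∀ j, Differentiable ℂ (v j) := fun j ↦ (hu j).fun_div (hu i) (h0 i)
  have hv0 : ∀ j z, v j z ≠ 0 := fun j z ↦ div_ne_zero (h0 _ z) (h0 i z)
  have hvsum : ∑ j, (-1 : ℂ) • v j = fun _ ↦ 1 := by
    ext z
    have h1 : u i z + ∑ j : {j // j ≠ i}, u j z = 0 := by
      rw [← hsum z, Fintype.sum_eq_add_sum_subtype_ne _ i]
    simp only [hv, Finset.sum_apply, Pi.smul_apply, smul_eq_mul, neg_one_mul,
      Finset.sum_neg_distrib, ← Finset.sum_div]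
    rw [eq_neg_of_add_eq_zero_right h1, neg_div, neg_neg, div_self (h0 i z)]
  have hspan : (fun _ ↦ 1 : ℂ → ℂ) ∈ Submodule.span ℂ (Set.range v) := by
    rw [← hvsum]
    exact Submodule.sum_mem _ fun j _ ↦ Submodule.smul_mem _ _ (Submodule.subset_span ⟨j, rfl⟩)
  -- The constant 1 is expanded in a maximal independent subfamily of the quotients u_j/u_i. The
  -- nonzero terms are independent, zero-free and sum to 1, so one quotient is constant.
  obtain ⟨s, hs, hsspan, hsli⟩ := exists_linearIndependent ℂ (Set.range v)
  rw [← hsspan] at hspan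
  rw [← Subtype.range_coe (s := s)] at hspan
  obtain ⟨l, hl⟩ := Finsupp.mem_span_range_iff_exists_finsupp.1 hspan
  have hne : l.support.Nonempty := by
    rw [Finsupp.support_nonempty_iff]
    rintro rfl
    simpa using congrFun hl 0
  obtain ⟨m, hm⟩ := Nat.exists_eq_succ_of_ne_zero (Finset.card_ne_zero.2 hne)
  let e : Fin (m + 1) ≃ l.support := (Finset.equivFinOfCardEq hm).symm
  have hl0 : ∀ k, l (e k) ≠ 0 := fun k ↦ Finsupp.mem_support_iff.1 (e k).2
  have hidx : ∀ k, ∃ j, v j = ((e k : s) : ℂ → ℂ) := fun k ↦ hs (e k : s).2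
  choose j hj using hidx
  have hwd : ∀ k, Differentiable ℂ (l (e k) • v (j k)) := fun k ↦ (hvd _).const_smul _
  have hw0 : ∀ k z, (l (e k) • v (j k)) z ≠ 0 := fun k z ↦ mul_ne_zero (hl0 k) (hv0 _ z)
  have hwli : LinearIndependent ℂ fun k ↦ l (e k) • v (j k) := by
    have h1 : LinearIndependent ℂ fun k ↦ v (j k) := by
      simp only [hj]
      exact hsli.comp (fun k ↦ (e k : s)) (Subtype.val_injective.comp e.injective)
    exact h1.units_smul fun k ↦ Units.mk0 _ (hl0 k)
  have hwsum : ∀ z, ∑ k, (l (e k) • v (j k)) z = 1 := by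
    intro z
    rw [← congrFun hl z, Finsupp.sum, Finset.sum_apply,
      ← Finset.sum_coe_sort l.support fun c ↦ (l c • (c : ℂ → ℂ)) z, ← Equiv.sum_comp e]
    simp only [hj]
  have hconst := eq_const_of_sum_eq_one hwd hw0 hwli hwsum 0
  refine ⟨j 0, (j 0).2, v (j 0) 0, fun z ↦ ?_⟩
  have h1 : v (j 0) z = v (j 0) 0 := mul_left_cancel₀ (hl0 0) (hconst z)
  rw [← h1]
  exact (div_mul_cancel₀ _ (h0 i z)).symm

theorem eventually_codiscrete_iff {p : ℂ → Prop} :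
    (∀ᶠ w in codiscrete ℂ, p w) ↔ ∀ z, ∀ᶠ w in 𝓝[≠] z, p w :=
  (mem_codiscreteWithin_iff_forall_mem_nhdsNE (S := {w | p w}) (T := Set.univ)).trans
    (by simp [Filter.Eventually])

theorem Continuous.eq_of_eventuallyEq_codiscrete {f g : ℂ → ℂ} (hf : Continuous f)
    (hg : Continuous g) (h : ∀ᶠ w in codiscrete ℂ, f w = g w) : f = g := by
  ext z
  have h1 : Tendsto f (𝓝[≠] z) (𝓝 (f z)) := (hf.tendsto z).mono_left nhdsWithin_le_nhds
  have h2 : Tendsto g (𝓝[≠] z) (𝓝 (g z)) := (hg.tendsto z).mono_left nhdsWithin_le_nhds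
  exact tendsto_nhds_unique_of_eventuallyEq h1 h2 (eventually_codiscrete_iff.1 h z)

/-! ### Homogeneous coordinates on the Riemann sphere -/

namespace OnePoint

/-- First homogeneous coordinate of a point of the Riemann sphere. -/
def homX : OnePoint ℂ → ℂ
  | infty => 1
  | some c => c

/-- Second homogeneous coordinate of a point of the Riemann sphere. -/
def homY : OnePoint ℂ → ℂ
  | infty => 0
  | some _ => 1

@[simp] theorem homX_infty : homX infty = 1 := rfl
@[simp] theorem homY_infty : homY infty = 0 := rfl
@[simp] theorem homX_coe (c : ℂ) : homX (c : OnePoint ℂ) = c := rfl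
@[simp] theorem homY_coe (c : ℂ) : homY (c : OnePoint ℂ) = 1 := rfl

/-- The determinant of the homogeneous coordinates of two points. -/
def homDet (a b : OnePoint ℂ) : ℂ := homX a * homY b - homX b * homY a

theorem homDet_ne_zero {a b : OnePoint ℂ} (h : a ≠ b) : homDet a b ≠ 0 := by
  induction a using OnePoint.rec <;> induction b using OnePoint.rec
  · exact absurd rfl h
  · simp [homDet]
  · simp [homDet]
  · simpa [homDet, sub_eq_zero] using h

/-- The point of the Riemann sphere with given homogeneous coordinates. -/
noncomputable def ofHom (p q : ℂ) : OnePoint ℂ := if q = 0 then infty else ((p / q : ℂ) : OnePoint ℂ)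

theorem ofHom_eq {p q : ℂ} {a : OnePoint ℂ} (hpq : p ≠ 0 ∨ q ≠ 0)
    (h : p * homY a = q * homX a) : ofHom p q = a := by
  induction a using OnePoint.rec with
  | infty => simp only [homY_infty, homX_infty, mul_zero, mul_one] at h; simp [ofHom, ← h]
  | coe c =>
    simp only [homY_coe, homX_coe, mul_one] at h
    have hq : q ≠ 0 := by
      rintro rfl
      simp [h] at hpq
    rw [ofHom, if_neg hq, h, mul_div_cancel_left₀ _ hq]

theorem smul_eq_ofHom (L : Matrix.GeneralLinearGroup (Fin 2) ℂ) (a : OnePoint ℂ) :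
    L • a = ofHom (L 0 0 * homX a + L 0 1 * homY a) (L 1 0 * homX a + L 1 1 * homY a) := by
  induction a using OnePoint.rec with
  | infty => simp [smul_infty_eq_ite, ofHom]
  | coe c => simp [smul_some_eq_ite, ofHom]

theorem smul_ofHom (L : Matrix.GeneralLinearGroup (Fin 2) ℂ) {p q : ℂ} (hpq : p ≠ 0 ∨ q ≠ 0) :
    L • ofHom p q = ofHom (L 0 0 * p + L 0 1 * q) (L 1 0 * p + L 1 1 * q) := by
  have hdet : L 0 0 * L 1 1 - L 0 1 * L 1 0 ≠ 0 := by
    rw [← Matrix.det_fin_two]; exact L.det_ne_zero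
  have hprop : ∀ x y : ℂ, x ≠ 0 ∨ y ≠ 0 →
      L 0 0 * x + L 0 1 * y ≠ 0 ∨ L 1 0 * x + L 1 1 * y ≠ 0 := by
    intro x y hxy
    by_contra! hc
    have h1 : (L 0 0 * L 1 1 - L 0 1 * L 1 0) * x = 0 := by
      linear_combination L 1 1 * hc.1 - L 0 1 * hc.2
    have h2 : (L 0 0 * L 1 1 - L 0 1 * L 1 0) * y = 0 := by
      linear_combination L 0 0 * hc.2 - L 1 0 * hc.1
    simp [hdet] at h1 h2
    simp [h1, h2] at hxy
  have key : homX (ofHom p q) ≠ 0 ∨ homY (ofHom p q) ≠ 0 := by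
    by_cases hq : q = 0 <;> simp [ofHom, hq]
  rw [smul_eq_ofHom]
  refine ofHom_eq (hprop _ _ key) ?_
  set P := L 0 0 * p + L 0 1 * q with hP
  set Q := L 1 0 * p + L 1 1 * q with hQ
  have h4 : homX (ofHom P Q) * Q = P * homY (ofHom P Q) := by
    by_cases hq : Q = 0 <;> simp [ofHom, hq]
  -- The normalised coordinates of a point differ from (p, q) by a scalar.
  have hab : ∃ s : ℂ, homX (ofHom p q) = s * p ∧ homY (ofHom p q) = s * q := by
    by_cases hq : q = 0
    · refine ⟨p⁻¹, ?_, ?_⟩ <;> simp_all [ofHom]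
    · refine ⟨q⁻¹, ?_, ?_⟩ <;> simp_all [ofHom, div_eq_inv_mul]
  obtain ⟨s, hsx, hsy⟩ := hab
  rw [hsx, hsy]
  linear_combination -s * h4

end OnePoint

open OnePoint

/-! ### Values of meromorphic functions -/

theorem sphereValue_eq_ofHom {f P Q : ℂ → ℂ} {z p q : ℂ} (hP : Tendsto P (𝓝[≠] z) (𝓝 p))
    (hQ : Tendsto Q (𝓝[≠] z) (𝓝 q)) (hpq : p ≠ 0 ∨ q ≠ 0)
    (hf : ∀ᶠ w in 𝓝[≠] z, Q w ≠ 0 ∧ f w = P w / Q w) : sphereValue f z = ofHom p q := by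
  refine Tendsto.limUnder_eq ?_
  by_cases hq : q = 0
  · have hp : p ≠ 0 := by simpa [hq] using hpq
    rw [ofHom, if_pos hq]
    have hinv : Tendsto (fun w ↦ (f w)⁻¹) (𝓝[≠] z) (𝓝[≠] 0) := by
      refine tendsto_nhdsWithin_iff.2 ⟨?_, ?_⟩
      · have h1 := hQ.div hP hp
        rw [hq, zero_div] at h1
        refine h1.congr' ?_
        filter_upwards [hf] with w hw
        rw [hw.2, inv_div]
        rfl
      · filter_upwards [hf, hP.eventually_ne hp] with w hw hw2
        simp [hw.2, hw.1, hw2]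
    have h2 : Tendsto f (𝓝[≠] z) (Bornology.cobounded ℂ) := by
      have := Filter.tendsto_inv₀_nhdsNE_zero.comp hinv
      simpa [Function.comp_def] using this
    rw [Metric.cobounded_eq_cocompact, ← coclosedCompact_eq_cocompact] at h2
    exact OnePoint.tendsto_coe_infty.comp h2
  · rw [ofHom, if_neg hq]
    refine (OnePoint.continuous_coe.tendsto _).comp ((hP.div hQ hq).congr' ?_)
    filter_upwards [hf] with w hw using hw.2.symm

theorem MeromorphicAt.exists_homogeneous {f : ℂ → ℂ} {z : ℂ} (hf : MeromorphicAt f z) :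
    ∃ (P Q : ℂ → ℂ) (p q : ℂ), Tendsto P (𝓝[≠] z) (𝓝 p) ∧ Tendsto Q (𝓝[≠] z) (𝓝 q) ∧
      (p ≠ 0 ∨ q ≠ 0) ∧ ∀ᶠ w in 𝓝[≠] z, Q w ≠ 0 ∧ f w = P w / Q w := by
  by_cases h : 0 ≤ meromorphicOrderAt f z
  · obtain ⟨c, hc⟩ := tendsto_nhds_of_meromorphicOrderAt_nonneg hf h
    exact ⟨f, fun _ ↦ 1, c, 1, hc, tendsto_const_nhds, Or.inr one_ne_zero,
      Eventually.of_forall fun w ↦ by simp⟩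
  · push Not at h
    have h1 := tendsto_cobounded_of_meromorphicOrderAt_neg h
    have h2 : ∀ᶠ w in 𝓝[≠] z, f w ≠ 0 := h1.eventually_ne_cobounded 0
    refine ⟨fun _ ↦ 1, fun w ↦ (f w)⁻¹, 1, 0, tendsto_const_nhds,
      Filter.tendsto_inv₀_cobounded.comp h1, Or.inl one_ne_zero, ?_⟩
    filter_upwards [h2] with w hw
    simp [hw]

/-- A denominator-free relation off a discrete set passes to every point, poles included, by taking
limits of homogeneous coordinates. -/
theorem sphereValue_eq_smul {f g : ℂ → ℂ} (hg : Meromorphic g)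
    (L : Matrix.GeneralLinearGroup (Fin 2) ℂ)
    (h : ∀ᶠ w in codiscrete ℂ, f w * (L 1 0 * g w + L 1 1) = L 0 0 * g w + L 0 1) (z : ℂ) :
    sphereValue f z = L • sphereValue g z := by
  have hdet : L 0 0 * L 1 1 - L 0 1 * L 1 0 ≠ 0 := by
    rw [← Matrix.det_fin_two]; exact L.det_ne_zero
  obtain ⟨P, Q, p, q, hP, hQ, hpq, hgPQ⟩ := (hg z).exists_homogeneous
  rw [sphereValue_eq_ofHom hP hQ hpq hgPQ, smul_ofHom L hpq]
  refine sphereValue_eq_ofHom ((hP.const_mul _).add (hQ.const_mul _))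
    ((hP.const_mul _).add (hQ.const_mul _)) ?_ ?_
  · by_contra! hc
    have h1 : (L 0 0 * L 1 1 - L 0 1 * L 1 0) * p = 0 := by
      linear_combination L 1 1 * hc.1 - L 0 1 * hc.2
    have h2 : (L 0 0 * L 1 1 - L 0 1 * L 1 0) * q = 0 := by
      linear_combination L 0 0 * hc.2 - L 1 0 * hc.1
    simp [hdet] at h1 h2
    simp [h1, h2] at hpq
  · filter_upwards [hgPQ, eventually_codiscrete_iff.1 h z] with w hw hfw
    have hne : L 1 0 * g w + L 1 1 ≠ 0 := by
      intro h0
      rw [h0, mul_zero] at hfw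
      exact hdet (by linear_combination L 1 0 * hfw + L 0 0 * h0)
    have hQ : L 1 0 * P w + L 1 1 * Q w = (L 1 0 * g w + L 1 1) * Q w := by
      rw [hw.2]; field_simp [hw.1]
    have hPw : L 0 0 * P w + L 0 1 * Q w = (L 0 0 * g w + L 0 1) * Q w := by
      rw [hw.2]; field_simp [hw.1]
    rw [hQ, hPw]
    exact ⟨mul_ne_zero hne hw.1, by rw [mul_div_mul_right _ _ hw.1, eq_div_iff hne, hfw]⟩

/-! ### Linear forms, pullback divisors and units -/

/-- The linear form vanishing at `a`, evaluated at a meromorphic function. -/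
noncomputable def linForm (a : OnePoint ℂ) (f : ℂ → ℂ) (z : ℂ) : ℂ := f z * homY a - homX a

theorem meromorphic_linForm {f : ℂ → ℂ} (hf : Meromorphic f) (a : OnePoint ℂ) :
    Meromorphic (linForm a f) := fun z ↦
  ((hf z).mul (MeromorphicAt.const _ z)).sub (MeromorphicAt.const _ z)

theorem IsNonconstant.order_linForm_ne_top {f : ℂ → ℂ} (hf : Meromorphic f) (hn : IsNonconstant f)
    (a : OnePoint ℂ) (z : ℂ) : meromorphicOrderAt (linForm a f) z ≠ ⊤ := by
  refine (Meromorphic.exists_meromorphicOrderAt_ne_top_iff_forall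
    (meromorphic_linForm hf a)).1 ?_ z
  by_contra! hc
  induction a using OnePoint.rec with
  | infty =>
    have h1 := meromorphicOrderAt_eq_top_iff.1 (hc 0)
    obtain ⟨w, hw⟩ := h1.exists
    simp [linForm] at hw
  | coe c =>
    refine hn ⟨(c : OnePoint ℂ), fun z ↦ Tendsto.limUnder_eq ?_⟩
    refine tendsto_const_nhds.congr' ?_
    filter_upwards [meromorphicOrderAt_eq_top_iff.1 (hc z)] with w hw
    simp only [linForm, homY_coe, homX_coe, mul_one, sub_eq_zero] at hw
    rw [hw]

theorem IsNonconstant.linForm_ne_zero {f : ℂ → ℂ} (hf : Meromorphic f) (hn : IsNonconstant f)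
    (a : OnePoint ℂ) : ∀ᶠ w in codiscrete ℂ, linForm a f w ≠ 0 :=
  eventually_codiscrete_iff.2 fun z ↦ (meromorphicOrderAt_ne_top_iff_eventually_ne_zero
    (meromorphic_linForm hf a z)).1 (hn.order_linForm_ne_top hf a z)

/-- Subtracting a constant does not change the poles, so the polar part is the same for all a and
cancels in quotients; for a = ∞ the form is the constant -1. -/
theorem divisor_linForm {f : ℂ → ℂ} (hf : Meromorphic f) (a : OnePoint ℂ) :
    MeromorphicOn.divisor (linForm a f) Set.univ
      = pullbackDivisor f a - pullbackDivisor f OnePoint.infty := by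
  induction a using OnePoint.rec with
  | infty =>
    have h1 : linForm OnePoint.infty f = fun _ ↦ -1 := by ext z; simp [linForm]
    rw [h1, sub_self]
    exact MeromorphicOn.divisor_const (-1 : ℂ)
  | coe c =>
    have h1 : linForm (c : OnePoint ℂ) f = fun z ↦ f z - c := by ext z; simp [linForm]
    have h2 : (MeromorphicOn.divisor (fun z ↦ f z - c) Set.univ)⁻
        = (MeromorphicOn.divisor f Set.univ)⁻ := by
      have := MeromorphicOn.negPart_divisor_add_of_analyticNhdOn_right (f₁ := f)
        (f₂ := fun _ ↦ -c) (U := Set.univ) (fun z _ ↦ hf z) (fun z _ ↦ analyticAt_const)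
      simpa [sub_eq_add_neg, Pi.add_def] using this
    rw [h1, pullbackDivisor_coe, pullbackDivisor_infty, ← h2, posPart_sub_negPart]

theorem pullbackDivisor_ne_zero_iff {f : ℂ → ℂ} (hf : Meromorphic f) (hn : IsNonconstant f)
    (a : OnePoint ℂ) (z : ℂ) : pullbackDivisor f a z ≠ 0 ↔ sphereValue f z = a := by
  induction a using OnePoint.rec with
  | infty =>
    rw [pullbackDivisor_infty, Function.locallyFinsuppWithin.negPart_apply,
      MeromorphicOn.divisor_apply (fun z _ ↦ hf z) (Set.mem_univ z)]
    by_cases h : 0 ≤ meromorphicOrderAt f z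
    · obtain ⟨c, -, hc⟩ := sphereValue_of_nonneg (hf z) h
      have h1 : 0 ≤ (meromorphicOrderAt f z).untop₀ := WithTop.untop₀_nonneg.2 h
      simp [hc, negPart_eq_zero.2 h1]
    · push Not at h
      have h1 := (sphereValue_of_neg h).2
      simp [h1, h]
  | coe c =>
    have h1 : linForm (c : OnePoint ℂ) f = fun z ↦ f z - c := by ext z; simp [linForm]
    have hmer := meromorphic_linForm hf (c : OnePoint ℂ)
    have hnt := hn.order_linForm_ne_top hf (c : OnePoint ℂ) z
    rw [h1] at hmer hnt
    rw [pullbackDivisor_coe, Function.locallyFinsuppWithin.posPart_apply,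
      MeromorphicOn.divisor_apply (fun z _ ↦ hmer z) (Set.mem_univ z)]
    have h2 : ((meromorphicOrderAt (fun z ↦ f z - c) z).untop₀)⁺ ≠ 0 ↔
        0 < meromorphicOrderAt (fun z ↦ f z - c) z := by
      -- Nonconstancy excludes the order ⊤, which `untop₀` would send to 0.
      lift meromorphicOrderAt (fun z ↦ f z - c) z to ℤ using hnt with m
      rw [ne_eq, posPart_eq_zero]
      simp
    rw [h2, ← tendsto_zero_iff_meromorphicOrderAt_pos (hmer z)]
    constructor
    · intro h
      have h3 : Tendsto f (𝓝[≠] z) (𝓝 c) := by simpa using h.add_const c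
      exact ((OnePoint.continuous_coe.tendsto c).comp h3).limUnder_eq
    · intro h
      by_cases h0 : 0 ≤ meromorphicOrderAt f z
      · obtain ⟨d, hd, hd2⟩ := sphereValue_of_nonneg (hf z) h0
        rw [h] at hd2
        have : c = d := by simpa using hd2
        rw [this]
        simpa using hd.sub_const d
      · push Not at h0
        rw [(sphereValue_of_neg h0).2] at h
        exact absurd h (by simp)

/-- Two meromorphic functions with the same divisor differ by an entire function without zeros. -/
theorem exists_unit_of_divisor_eq {φ ψ : ℂ → ℂ} (hφ : Meromorphic φ) (hψ : Meromorphic ψ)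
    (hφt : ∀ z, meromorphicOrderAt φ z ≠ ⊤) (hψt : ∀ z, meromorphicOrderAt ψ z ≠ ⊤)
    (h : MeromorphicOn.divisor φ Set.univ = MeromorphicOn.divisor ψ Set.univ) :
    ∃ u : ℂ → ℂ, Differentiable ℂ u ∧ (∀ z, u z ≠ 0) ∧
      ∀ᶠ w in codiscrete ℂ, φ w = u w * ψ w := by
  have hm : MeromorphicOn (φ * ψ⁻¹) Set.univ := fun z _ ↦ (hφ z).mul (hψ z).inv
  have hord : ∀ z, meromorphicOrderAt (φ * ψ⁻¹) z = 0 := by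
    intro z
    have h1 := DFunLike.congr_fun h z
    rw [MeromorphicOn.divisor_apply (fun z _ ↦ hφ z) (Set.mem_univ z),
      MeromorphicOn.divisor_apply (fun z _ ↦ hψ z) (Set.mem_univ z)] at h1
    rw [meromorphicOrderAt_mul (hφ z) (hψ z).inv, meromorphicOrderAt_inv]
    have h2 := hφt z
    have h3 := hψt z
    lift meromorphicOrderAt φ z to ℤ using h2 with m
    lift meromorphicOrderAt ψ z to ℤ using h3 with k
    simp only [WithTop.untop₀_coe] at h1
    rw [h1]
    norm_cast
    simp
  -- The quotient has order 0 everywhere; its normal form fills in the removable singularities.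
  set u := toMeromorphicNFOn (φ * ψ⁻¹) Set.univ with hu
  have hnf : ∀ z, MeromorphicNFAt u z := fun z ↦
    meromorphicNFOn_toMeromorphicNFOn _ _ (Set.mem_univ z)
  have huo : ∀ z, meromorphicOrderAt u z = 0 := fun z ↦ by
    rw [hu, meromorphicOrderAt_toMeromorphicNFOn hm (Set.mem_univ z), hord]
  refine ⟨u, fun z ↦ ((hnf z).meromorphicOrderAt_nonneg_iff_analyticAt.1
    (huo z).ge).differentiableAt, fun z ↦ (hnf z).meromorphicOrderAt_eq_zero_iff.1 (huo z), ?_⟩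
  have h1 : ∀ᶠ w in codiscrete ℂ, ψ w ≠ 0 := eventually_codiscrete_iff.2 fun z ↦
    (meromorphicOrderAt_ne_top_iff_eventually_ne_zero (hψ z)).1 (hψt z)
  filter_upwards [toMeromorphicNFOn_eqOn_codiscrete hm, h1] with w hw hw1
  rw [hu, ← hw, Pi.mul_apply, Pi.inv_apply, inv_mul_cancel_right₀ hw1]

/-! ### The quadratic relation among four units -/

theorem eq_const_mul_of_sq_eq {x y : ℂ → ℂ} (hx : Differentiable ℂ x) (hy : Differentiable ℂ y)
    (hy0 : ∀ z, y z ≠ 0) {c : ℂ} (h : ∀ z, x z ^ 2 = c * y z ^ 2) : ∃ d : ℂ, ∀ z, x z = d * y z := by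
  have hq : Differentiable ℂ fun z ↦ x z / y z := hx.fun_div hy hy0
  have hsq : ∀ z, (x z / y z) ^ 2 = c := fun z ↦ by
    rw [div_pow, h, mul_div_cancel_right₀ _ (pow_ne_zero 2 (hy0 z))]
  have hder : ∀ z, deriv (fun z ↦ x z / y z) z = 0 := by
    intro z
    have h1 := ((hq z).hasDerivAt.fun_pow 2).deriv
    simp only [hsq, deriv_const] at h1
    by_cases h2 : x z / y z = 0
    · have h3 : c = 0 := by rw [← hsq z, h2]; simp
      have h4 : (fun z ↦ x z / y z) = fun _ ↦ 0 := funext fun w ↦ by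
        have := hsq w
        rw [h3] at this
        exact pow_eq_zero_iff two_ne_zero |>.1 this
      rw [h4, deriv_const]
    · simpa [h2] using h1.symm
  refine ⟨x 0 / y 0, fun z ↦ ?_⟩
  rw [← is_const_of_deriv_eq_zero hq hder z 0, div_mul_cancel₀ _ (hy0 z)]

theorem exists_eq_const_mul_of_term_eq {p q c : ℂ} {x x' y T S : ℂ → ℂ} (hp : p ≠ 0)
    (hy : ∀ z, y z ≠ 0) (hT : ∀ z, T z = p * (x z * y z)) (hS : ∀ z, S z = q * (x' z * y z))
    (h : ∀ z, T z = c * S z) : ∃ d : ℂ, ∀ z, x z = d * x' z := by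
  refine ⟨c * q / p, fun z ↦ ?_⟩
  have h1 := h z
  rw [hT, hS] at h1
  have h2 : p * x z = c * q * x' z := mul_right_cancel₀ (hy z) (by linear_combination h1)
  field_simp
  linear_combination h2

/-- Four entire functions without zeros whose pairwise products satisfy a linear relation with
nonzero coefficients: two of the functions are proportional. -/
theorem exists_proportional_of_quadratic_relation {u : Fin 4 → ℂ → ℂ}
    (hu : ∀ i, Differentiable ℂ (u i)) (h0 : ∀ i z, u i z ≠ 0) {c : Fin 6 → ℂ} (hc : ∀ i, c i ≠ 0)
    (h : ∀ z, c 0 * (u 2 z * u 3 z) + c 1 * (u 1 z * u 3 z) + c 2 * (u 1 z * u 2 z)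
      + c 3 * (u 0 z * u 3 z) + c 4 * (u 0 z * u 2 z) + c 5 * (u 0 z * u 1 z) = 0) :
    ∃ i k, i ≠ k ∧ ∃ d : ℂ, ∀ z, u i z = d * u k z := by
  -- Terms s and 5 - s belong to complementary pairs. Any two other distinct terms share an index,
  -- and their common factor cancels.
  set P : Fin 6 → Fin 4 × Fin 4 := ![(2, 3), (1, 3), (1, 2), (0, 3), (0, 2), (0, 1)] with hP
  set T : Fin 6 → ℂ → ℂ := fun s z ↦ c s * (u (P s).1 z * u (P s).2 z) with hT
  have hTd : ∀ s, Differentiable ℂ (T s) := fun s ↦ ((hu _).mul (hu _)).const_mul _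
  have hT0 : ∀ s z, T s z ≠ 0 := fun s z ↦ mul_ne_zero (hc s) (mul_ne_zero (h0 _ z) (h0 _ z))
  have hTsum : ∀ z, ∑ s, T s z = 0 := by
    intro z
    rw [← h z]
    simp [Fin.sum_univ_six, hT, hP]
  have borel := exists_ne_eq_const_mul_of_sum_eq_zero hTd hT0 hTsum
  have share : ∀ {s t : Fin 6} {d : ℂ} (i k m : Fin 4), i ≠ k → (∀ z, T s z = d * T t z) →
      (P s = (i, m) ∨ P s = (m, i)) → (P t = (k, m) ∨ P t = (m, k)) →
      ∃ i k, i ≠ k ∧ ∃ d : ℂ, ∀ z, u i z = d * u k z := by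
    intro s t d i k m hik hst hs ht
    refine ⟨i, k, hik, exists_eq_const_mul_of_term_eq (hc s) (h0 m)
      (q := c t) (T := T s) (S := T t) (fun z ↦ ?_) (fun z ↦ ?_) hst⟩
    · rcases hs with hs | hs
      · simp only [hT, hs]
      · simp only [hT, hs]
        ring
    · rcases ht with ht | ht
      · simp only [hT, ht]
      · simp only [hT, ht]
        ring
  obtain ⟨j, hj, d, hd⟩ := borel 0
  fin_cases j
  · exact absurd rfl hj
  · exact share 1 2 3 (by decide) hd (by simp [hP]) (by simp [hP])
  · exact share 1 3 2 (by decide) hd (by simp [hP]) (by simp [hP])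
  · exact share 0 2 3 (by decide) hd (by simp [hP]) (by simp [hP])
  · exact share 0 3 2 (by decide) hd (by simp [hP]) (by simp [hP])
  obtain ⟨k, hk, e, he⟩ := borel 1
  fin_cases k
  · exact share 2 1 3 (by decide) he (by simp [hP]) (by simp [hP])
  · exact absurd rfl hk
  · exact share 2 3 1 (by decide) he (by simp [hP]) (by simp [hP])
  · exact share 0 1 3 (by decide) he (by simp [hP]) (by simp [hP])
  swap
  · exact share 0 3 1 (by decide) he (by simp [hP]) (by simp [hP])
  -- Only complementary partners remain: u₀u₁ ∝ u₂u₃ and u₀u₂ ∝ u₁u₃, whence u₁² ∝ u₂².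
  refine ⟨1, 2, by decide, eq_const_mul_of_sq_eq (hu 1) (hu 2) (h0 2)
    (c := d * c 0 * c 4 / (e * c 1 * c 5)) fun z ↦ ?_⟩
  have h1 : c 5 * (u 0 z * u 1 z) = d * (c 0 * (u 2 z * u 3 z)) := hd z
  have h2 : c 4 * (u 0 z * u 2 z) = e * (c 1 * (u 1 z * u 3 z)) := he z
  have he0 : e ≠ 0 := by
    rintro rfl
    rw [zero_mul] at h2
    exact mul_ne_zero (hc 4) (mul_ne_zero (h0 0 z) (h0 2 z)) h2
  have hc1 := hc 1
  have hc5 := hc 5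
  rw [div_mul_eq_mul_div, eq_div_iff (by positivity)]
  refine mul_right_cancel₀ (mul_ne_zero (h0 0 z) (h0 3 z)) ?_
  linear_combination (e * c 1 * u 1 z * u 3 z) * h1 - (d * c 0 * u 2 z * u 3 z) * h2

/-- The elimination of `x` and `y` from `x Y(aᵢ) - X(aᵢ) = φᵢ (y Y(bᵢ) - X(bᵢ))`, `i = 0, …, 3`. -/
theorem quadratic_relation_of_linear {X Y X' Y' φ : Fin 4 → ℂ} {x y : ℂ}
    (h : ∀ i, x * Y i - X i = φ i * (y * Y' i - X' i)) :
    (X 0 * Y 1 - X 1 * Y 0) * (X' 2 * Y' 3 - X' 3 * Y' 2) * (φ 2 * φ 3)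
      - (X 0 * Y 2 - X 2 * Y 0) * (X' 1 * Y' 3 - X' 3 * Y' 1) * (φ 1 * φ 3)
      + (X 0 * Y 3 - X 3 * Y 0) * (X' 1 * Y' 2 - X' 2 * Y' 1) * (φ 1 * φ 2)
      + (X 1 * Y 2 - X 2 * Y 1) * (X' 0 * Y' 3 - X' 3 * Y' 0) * (φ 0 * φ 3)
      - (X 1 * Y 3 - X 3 * Y 1) * (X' 0 * Y' 2 - X' 2 * Y' 0) * (φ 0 * φ 2)
      + (X 2 * Y 3 - X 3 * Y 2) * (X' 0 * Y' 1 - X' 1 * Y' 0) * (φ 0 * φ 1) = 0 := by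
  -- The vector (-1, x, 1, -y) lies in the kernel of M; the relation is the Laplace expansion of det
  -- M by its first two columns.
  set M : Matrix (Fin 4) (Fin 4) ℂ :=
    Matrix.of fun i ↦ ![X i, Y i, φ i * X' i, φ i * Y' i] with hM
  have h1 : M.det = 0 := by
    refine Matrix.exists_mulVec_eq_zero_iff.1 ⟨![-1, x, 1, -y], ?_, ?_⟩
    · intro h0
      simpa using congrFun h0 0
    · ext i
      have := h i
      simp only [hM, Matrix.mulVec, dotProduct, Fin.sum_univ_four, Matrix.of_apply]
      simp
      linear_combination this
  rw [← h1, Matrix.det_succ_row_zero]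
  simp [Fin.sum_univ_succ, Matrix.det_fin_three, hM, Fin.succAbove, Matrix.submatrix]
  ring

/-! ### Picard's theorem and the Möbius transformation -/

/-- Picard's little theorem: a nonconstant meromorphic function omits at most two values. -/
theorem IsNonconstant.not_omits_three {f : ℂ → ℂ} (hf : Meromorphic f) (hn : IsNonconstant f)
    {a b c : OnePoint ℂ} (hab : a ≠ b) (hac : a ≠ c) (hbc : b ≠ c)
    (ha : ∀ z, sphereValue f z ≠ a) (hb : ∀ z, sphereValue f z ≠ b)
    (hc : ∀ z, sphereValue f z ≠ c) : False := by
  have hzero : ∀ d : OnePoint ℂ, (∀ z, sphereValue f z ≠ d) → pullbackDivisor f d = 0 := by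
    intro d hd
    ext z
    by_contra h
    exact hd z ((pullbackDivisor_ne_zero_iff hf hn d z).1 h)
  have hunit : ∀ d : OnePoint ℂ, (∀ z, sphereValue f z ≠ d) → ∃ u : ℂ → ℂ, Differentiable ℂ u ∧
      (∀ z, u z ≠ 0) ∧ ∀ᶠ w in codiscrete ℂ, linForm d f w = u w * linForm c f w := by
    intro d hd
    refine exists_unit_of_divisor_eq (meromorphic_linForm hf d) (meromorphic_linForm hf c)
      (hn.order_linForm_ne_top hf d) (hn.order_linForm_ne_top hf c) ?_
    rw [divisor_linForm hf, divisor_linForm hf, hzero d hd, hzero c hc]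
  obtain ⟨u, hu, hu0, hul⟩ := hunit a ha
  obtain ⟨v, hv, hv0, hvl⟩ := hunit b hb
  -- Three linear forms in two variables are dependent; dividing by the form of c leaves three
  -- zero-free terms.
  have hrel : ∀ z, homDet b c * u z + homDet c a * v z + homDet a b = 0 := by
    refine congrFun (Continuous.eq_of_eventuallyEq_codiscrete (g := fun _ ↦ 0)
      (((hu.continuous.const_mul _).add (hv.continuous.const_mul _)).add continuous_const)
      continuous_const ?_)
    filter_upwards [hul, hvl, hn.linForm_ne_zero hf c] with w h1 h2 h3
    refine mul_right_cancel₀ h3 ?_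
    have h4 : homDet b c * linForm a f w + homDet c a * linForm b f w
        + homDet a b * linForm c f w = 0 := by simp only [homDet, linForm]; ring
    linear_combination h4 - homDet b c * h1 - homDet c a * h2
  have h1 := homDet_ne_zero hbc
  have h2 := homDet_ne_zero hac.symm
  have h3 := homDet_ne_zero hab
  have hconst : ∃ κ : ℂ, ∀ z, u z = κ := by
    set T : Fin 3 → ℂ → ℂ :=
      ![fun z ↦ homDet b c * u z, fun z ↦ homDet c a * v z, fun _ ↦ homDet a b] with hT
    obtain ⟨j, hj, e, he⟩ := exists_ne_eq_const_mul_of_sum_eq_zero (u := T)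
      (fun i ↦ by
        fin_cases i
        exacts [hu.const_mul _, hv.const_mul _, differentiable_const _])
      (fun i z ↦ by
        fin_cases i
        exacts [mul_ne_zero h1 (hu0 z), mul_ne_zero h2 (hv0 z), h3])
      (fun z ↦ by simpa [Fin.sum_univ_three, hT] using hrel z) 0
    fin_cases j
    · exact absurd rfl hj
    · refine ⟨-homDet a b / (homDet b c * (1 + e)), fun z ↦ ?_⟩
      have h4 : homDet c a * v z = e * (homDet b c * u z) := he z
      have h5 : u z * (homDet b c * (1 + e)) = -homDet a b := by
        linear_combination hrel z - h4
      refine (eq_div_iff fun h6 ↦ h3 ?_).2 h5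
      rw [h6, mul_zero] at h5
      linear_combination h5
    · refine ⟨homDet a b / (homDet b c * e), fun z ↦ ?_⟩
      have h4 : homDet a b = e * (homDet b c * u z) := he z
      refine (eq_div_iff fun h6 ↦ h3 ?_).2 (by linear_combination -h4)
      linear_combination h4 + u z * h6
  obtain ⟨κ, hκ⟩ := hconst
  -- With u constant this is a linear equation for f: either it degenerates, forcing a = c, or f is
  -- constant.
  have hlin : ∀ᶠ w in codiscrete ℂ, f w * (homY a - κ * homY c) = homX a - κ * homX c := by
    filter_upwards [hul] with w hw
    rw [hκ] at hw
    simp only [linForm] at hw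
    linear_combination hw
  by_cases hY : homY a - κ * homY c = 0
  · obtain ⟨w, hw⟩ := (eventually_codiscrete_iff.1 hlin 0).exists
    rw [hY, mul_zero] at hw
    refine homDet_ne_zero hac ?_
    rw [homDet]
    linear_combination -homY c * hw - homX c * hY
  · obtain ⟨w, hw, hw2⟩ := ((eventually_codiscrete_iff.1 hlin 0).and (eventually_codiscrete_iff.1
      (hn.linForm_ne_zero hf (((homX a - κ * homX c) / (homY a - κ * homY c) : ℂ) : OnePoint ℂ))
      0)).exists
    simp only [linForm, homY_coe, homX_coe, mul_one, ← hw] at hw2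
    exact hw2 (by rw [mul_div_cancel_right₀ _ hY, sub_self])

/-- The linear forms of two functions which share four pairs of values are related by units, up to
one common factor. -/
theorem exists_units_of_pullbackDivisor_eq {a b : Fin 4 → OnePoint ℂ} {f g : ℂ → ℂ}
    (hf : Meromorphic f) (hg : Meromorphic g) (hfn : IsNonconstant f) (hgn : IsNonconstant g)
    (hfg : ∀ j, pullbackDivisor f (a j) = pullbackDivisor g (b j)) :
    ∃ u : Fin 4 → ℂ → ℂ, (∀ i, Differentiable ℂ (u i)) ∧ (∀ i z, u i z ≠ 0) ∧
      ∀ i, ∀ᶠ w in codiscrete ℂ, linForm (a i) f w * linForm (b 0) g w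
        = u i w * (linForm (a 0) f w * linForm (b i) g w) := by
  have hmer : ∀ i j, Meromorphic (linForm (a i) f * linForm (b j) g) := fun i j z ↦
    (meromorphic_linForm hf (a i) z).mul (meromorphic_linForm hg (b j) z)
  have hord : ∀ i j z, meromorphicOrderAt (linForm (a i) f * linForm (b j) g) z ≠ ⊤ := by
    intro i j z
    rw [meromorphicOrderAt_mul (meromorphic_linForm hf _ z) (meromorphic_linForm hg _ z)]
    exact WithTop.add_ne_top.2
      ⟨hfn.order_linForm_ne_top hf _ z, hgn.order_linForm_ne_top hg _ z⟩
  have hdiv : ∀ i j, MeromorphicOn.divisor (linForm (a i) f * linForm (b j) g) Set.univ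
      = (pullbackDivisor f (a i) - pullbackDivisor f OnePoint.infty)
        + (pullbackDivisor g (b j) - pullbackDivisor g OnePoint.infty) := by
    intro i j
    rw [MeromorphicOn.divisor_mul (fun z _ ↦ meromorphic_linForm hf _ z)
      (fun z _ ↦ meromorphic_linForm hg _ z) (fun z _ ↦ hfn.order_linForm_ne_top hf _ z)
      (fun z _ ↦ hgn.order_linForm_ne_top hg _ z), divisor_linForm hf, divisor_linForm hg]
  -- Cross-multiplying with index 0 puts the polar divisors of f and g once on each side.
  have key := fun i ↦ exists_unit_of_divisor_eq (hmer i 0) (hmer 0 i) (hord i 0) (hord 0 i) (by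
    rw [hdiv, hdiv, hfg, hfg]; abel)
  choose u hu hu0 hul using key
  exact ⟨u, hu, hu0, hul⟩

theorem smul_eq_of_hom {L : Matrix.GeneralLinearGroup (Fin 2) ℂ} {a b : OnePoint ℂ} {s : ℂ}
    (hs : s ≠ 0) (hX : L 0 0 * homX b + L 0 1 * homY b = s * homX a)
    (hY : L 1 0 * homX b + L 1 1 * homY b = s * homY a) : L • b = a := by
  rw [smul_eq_ofHom, hX, hY]
  refine ofHom_eq ?_ (by ring)
  induction a using OnePoint.rec <;> simp [hs]

/-- Two meromorphic functions which share four pairs of values are Möbius transformations of each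
other, by a Möbius transformation respecting two of the pairs. -/
theorem exists_moebius_of_pullbackDivisor_eq {a b : Fin 4 → OnePoint ℂ}
    (ha : Function.Injective a) (hb : Function.Injective b) {f g : ℂ → ℂ}
    (hf : Meromorphic f) (hg : Meromorphic g) (hfn : IsNonconstant f) (hgn : IsNonconstant g)
    (hfg : ∀ j, pullbackDivisor f (a j) = pullbackDivisor g (b j)) :
    ∃ L : Matrix.GeneralLinearGroup (Fin 2) ℂ, (∀ z, sphereValue f z = L • sphereValue g z) ∧
      ∃ i k, i ≠ k ∧ L • b i = a i ∧ L • b k = a k := by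
  obtain ⟨u, hu, hu0, hul⟩ := exists_units_of_pullbackDivisor_eq hf hg hfn hgn hfg
  have hWa : ∀ i k, i ≠ k → homDet (a i) (a k) ≠ 0 := fun i k h ↦ homDet_ne_zero (ha.ne h)
  have hWb : ∀ i k, i ≠ k → homDet (b i) (b k) ≠ 0 := fun i k h ↦ homDet_ne_zero (hb.ne h)
  obtain ⟨i, k, hik, d, hd⟩ : ∃ i k, i ≠ k ∧ ∃ d : ℂ, ∀ z, u i z = d * u k z := by
    refine exists_proportional_of_quadratic_relation hu hu0
      (c := ![homDet (a 0) (a 1) * homDet (b 2) (b 3), -(homDet (a 0) (a 2) * homDet (b 1) (b 3)),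
        homDet (a 0) (a 3) * homDet (b 1) (b 2), homDet (a 1) (a 2) * homDet (b 0) (b 3),
        -(homDet (a 1) (a 3) * homDet (b 0) (b 2)), homDet (a 2) (a 3) * homDet (b 0) (b 1)])
      (fun s ↦ ?_) ?_
    · fin_cases s
      exacts [mul_ne_zero (hWa _ _ (by decide)) (hWb _ _ (by decide)),
        neg_ne_zero.2 (mul_ne_zero (hWa _ _ (by decide)) (hWb _ _ (by decide))),
        mul_ne_zero (hWa _ _ (by decide)) (hWb _ _ (by decide)),
        mul_ne_zero (hWa _ _ (by decide)) (hWb _ _ (by decide)),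
        neg_ne_zero.2 (mul_ne_zero (hWa _ _ (by decide)) (hWb _ _ (by decide))),
        mul_ne_zero (hWa _ _ (by decide)) (hWb _ _ (by decide))]
    · have hc := fun i ↦ (hu i).continuous
      refine congrFun (Continuous.eq_of_eventuallyEq_codiscrete (g := fun _ ↦ 0) (by fun_prop)
        continuous_const ?_)
      filter_upwards [hul 0, hul 1, hul 2, hul 3, hfn.linForm_ne_zero hf (a 0),
        hgn.linForm_ne_zero hg (b 0)] with w h0 h1 h2 h3 hA hB
      set t := linForm (a 0) f w / linForm (b 0) g w with ht
      have ht0 : t ≠ 0 := div_ne_zero hA hB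
      have hlin : ∀ i, f w * homY (a i) - homX (a i)
          = (t * u i w) * (g w * homY (b i) - homX (b i)) := by
        intro i
        have hi : linForm (a i) f w * linForm (b 0) g w
            = u i w * (linForm (a 0) f w * linForm (b i) g w) := by
          fin_cases i
          exacts [h0, h1, h2, h3]
        change linForm (a i) f w = t * u i w * linForm (b i) g w
        rw [ht]
        field_simp
        linear_combination hi
      have h4 := quadratic_relation_of_linear hlin
      refine mul_left_cancel₀ (pow_ne_zero 2 ht0) ?_
      simp only [homDet, Matrix.cons_val]
      linear_combination h4
  have hd0 : d ≠ 0 := by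
    rintro rfl
    exact hu0 i 0 (by simpa using hd 0)
  have hrel : ∀ᶠ w in codiscrete ℂ, linForm (a i) f w * linForm (b k) g w
      = d * (linForm (b i) g w * linForm (a k) f w) := by
    filter_upwards [hul i, hul k, hgn.linForm_ne_zero hg (b 0), hfn.linForm_ne_zero hf (a 0)]
      with w hi hk hB hA
    rw [hd] at hi
    refine mul_left_cancel₀ (mul_ne_zero (mul_ne_zero (hu0 k w) hB) hA) ?_
    linear_combination (u k w * linForm (a 0) f w * linForm (b k) g w) * hi
      - (d * u k w * linForm (a 0) f w * linForm (b i) g w) * hk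
  -- The coefficients obtained by solving `hrel` for f in terms of g. At b_i the terms with d drop
  -- out, at b_k the others do.
  set M : Matrix (Fin 2) (Fin 2) ℂ :=
    !![homX (a i) * homY (b k) - d * homX (a k) * homY (b i),
      -homX (a i) * homX (b k) + d * homX (a k) * homX (b i);
      homY (a i) * homY (b k) - d * homY (a k) * homY (b i),
      -homY (a i) * homX (b k) + d * homY (a k) * homX (b i)] with hM
  have hdet : M.det ≠ 0 := by
    have : M.det = d * (homDet (a i) (a k) * homDet (b i) (b k)) := by
      rw [Matrix.det_fin_two]
      simp only [hM, homDet, Matrix.of_apply, Matrix.cons_val]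
      ring
    rw [this]
    exact mul_ne_zero hd0 (mul_ne_zero (hWa _ _ hik) (hWb _ _ hik))
  obtain ⟨L, hL⟩ : ∃ L : Matrix.GeneralLinearGroup (Fin 2) ℂ, ∀ i j, L i j = M i j :=
    ⟨Matrix.GeneralLinearGroup.mkOfDetNeZero M hdet, fun _ _ ↦ rfl⟩
  refine ⟨L, sphereValue_eq_smul hg _ ?_, i, k, hik,
    smul_eq_of_hom (hWb i k hik) ?_ ?_,
    smul_eq_of_hom (mul_ne_zero hd0 (hWb i k hik)) ?_ ?_⟩
  · filter_upwards [hrel] with w hw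
    simp only [linForm] at hw
    simp only [hL, hM, Matrix.of_apply, Matrix.cons_val]
    linear_combination hw
  all_goals
    simp only [hL, hM, homDet, Matrix.of_apply, Matrix.cons_val]
    ring

/-- Möbius transformations are given by the action of `GL (Fin 2) ℂ` on the Riemann sphere
`OnePoint ℂ` by linear fractional transformations. -/
theorem mainTheorem8 (a b : Fin 4 → OnePoint ℂ)
    (ha : Function.Injective a) (hb : Function.Injective b)
    (f g : ℂ → ℂ) (hf : Meromorphic f) (hg : Meromorphic g)
    (hf_nonconst : IsNonconstant f) (hg_nonconst : IsNonconstant g)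
    (hfg : ∀ j : Fin 4, pullbackDivisor f (a j) = pullbackDivisor g (b j)) :
    ∃ L : Matrix.GeneralLinearGroup (Fin 2) ℂ,
      (∀ z : ℂ, sphereValue f z = L • sphereValue g z) ∧
      ((∃ k₁ k₂ k₃ : Fin 4, k₁ ≠ k₂ ∧ k₁ ≠ k₃ ∧ k₂ ≠ k₃ ∧
          L • b k₁ = a k₁ ∧ L • b k₂ = a k₂ ∧ L • b k₃ = a k₃) ∨
        (∃ k : Equiv.Perm (Fin 4),
          L • b (k 0) = a (k 0) ∧ L • b (k 1) = a (k 1) ∧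
          L • b (k 2) = a (k 3) ∧ L • b (k 3) = a (k 2))) := by
  obtain ⟨L, hL, i, k, hik, hi, hk⟩ :=
    exists_moebius_of_pullbackDivisor_eq ha hb hf hg hf_nonconst hg_nonconst hfg
  refine ⟨L, hL, ?_⟩
  -- A permutation with 0 ↦ i and 1 ↦ k.
  set σ : Equiv.Perm (Fin 4) := Equiv.swap (Equiv.swap 0 i 1) k * Equiv.swap 0 i with hσ
  have hσ0 : σ 0 = i := by
    have h1 : i ≠ Equiv.swap 0 i 1 := fun h ↦ by
      have := (Equiv.swap 0 i).injective ((Equiv.swap_apply_left 0 i).trans h)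
      exact absurd this (by decide)
    rw [hσ, Equiv.Perm.mul_apply, Equiv.swap_apply_left, Equiv.swap_apply_of_ne_of_ne h1 hik]
  have hσ1 : σ 1 = k := by rw [hσ, Equiv.Perm.mul_apply, Equiv.swap_apply_left]
  rw [← hσ0] at hi
  rw [← hσ1] at hk
  have hne : ∀ {s t : Fin 4}, s ≠ t → σ s ≠ σ t := fun h ↦ σ.injective.ne h
  by_cases h2 : L • b (σ 2) = a (σ 2)
  · exact Or.inl ⟨_, _, _, hne (by decide), hne (by decide), hne (by decide), hi, hk, h2⟩
  by_cases h3 : L • b (σ 3) = a (σ 3)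
  · exact Or.inl ⟨_, _, _, hne (by decide), hne (by decide), hne (by decide), hi, hk, h3⟩
  have hiff : ∀ j z, sphereValue f z = a j ↔ sphereValue g z = b j := fun j z ↦ by
    rw [← pullbackDivisor_ne_zero_iff hf hf_nonconst, ← pullbackDivisor_ne_zero_iff hg hg_nonconst,
      hfg]
  -- At a point where f is a_j or L(b_j), g equals b_j, so f equals both values there.
  have homit : ∀ j, L • b j ≠ a j →
      (∀ z, sphereValue f z ≠ a j) ∧ ∀ z, sphereValue f z ≠ L • b j := by
    intro j hj
    have h : ∀ z, sphereValue f z ≠ a j := fun z hz ↦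
      hj (by rw [← hz, hL, (hiff j z).1 hz])
    refine ⟨h, fun z hz ↦ h z ((hiff j z).2 ?_)⟩
    rw [hL] at hz
    exact MulAction.injective L hz
  obtain ⟨ha2, hb2⟩ := homit _ h2
  obtain ⟨ha3, hb3⟩ := homit _ h3
  have ha23 : a (σ 2) ≠ a (σ 3) := ha.ne (hne (by decide))
  -- Unless L interchanges the two remaining pairs, f omits three distinct values.
  refine Or.inr ⟨σ, hi, hk, ?_, ?_⟩
  · by_contra h
    exact hf_nonconst.not_omits_three hf ha23 (Ne.symm h2) (Ne.symm h) ha2 ha3 hb2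
  · by_contra h
    exact hf_nonconst.not_omits_three hf ha23 (Ne.symm h) (Ne.symm h3) ha2 ha3 hb3
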